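/- Let $n' \ge m \ge 3$ be integers, let $\mathbb{F}_{2^n}$ be a field with $2^n$ elements with basis $1, z, \ldots, z^{n-1}$ over $\mathbb{F}_2$, let $W \subseteq \mathbb{F}_{2^n}$ be an $\mathbb{F}_2$-subspace of dimension $n'$ with basis $\nu_1,\ldots,\nu_{n'}$, and let $a_6, c \in \mathbb{F}_{2^n}\setminus\{0\}$. Summation polynomials. For the elliptic curve $y^2+xy=x^3+a_2x^2+a_6$ put $$S_3(x_1,x_2,x_3) = (x_1^2+x_2^2)x_3^2 + x_1x_2x_3 + x_1^2x_2^2 + a_6,$$ $$S_{k+1}(x_1,\ldots,x_{k+1}) = \mathrm{Res}_X\big(S_k(x_1,\ldots,x_{k-1},X),\, S_3(x_k,x_{k+1},X)\big) \quad (k\ge 3),$$ where the resultant is the determinant of the Sylvester matrix of polynomials of degrees $2^{k-2}$ and $2$ in $X$. Weil descent. With variables $y_{il}$ ($1\le i\le m$, $1\le l\le n'$) and $x_i=\sum_{l=1}^{n'} y_{il}\nu_l$, write $$S_{m+1}(x_1,\ldots,x_m,c) = f_0+zf_1+\cdots+z^{n-1}f_{n-1}, \qquad f_k\in\mathbb{F}_2[y_{il}],$$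 and let $s_k$ be the class of $f_k$ modulo the polynomials $y_{il}^2-y_{il}$. First fall degree. Let $K$ be a field of characteristic $2$, $A=K[y_{il}]/(y_{il}^2-y_{il})$, $[A]_d$ the space of classes of polynomials of degree at most $d$, and $S=K[y_{il}]/(y_{il}^2)=\bigoplus_d S_d$ the associated graded ring, so that $S_d=[A]_d/[A]_{d-1}$. Let $V\subseteq A$ be a linear subspace, $d$ the least integer with $V\subseteq[A]_d$, and $\bar V\subseteq S_d$ the image of $V$. If $\dim_K\bar V<\dim_K V$, put $D_{ff}(V)=d$. Otherwise let $h_1,\ldots,h_r$ be a basis of $\bar V$, let $e_1,\ldots,e_r$ be the standard basis of $S^r$, and let $U\subseteq S^r$ be the $S$-submodule generated by all $h_je_i+h_ie_j$ and $h_ke_k$; then $D_{ff}(V)$ is the smallest $j\ge d$ for which there are $g_1,\ldots,g_r\in S_{j-d}$ with $\sum_i g_ih_i=0$ and $(g_1,\ldots,g_r)\notin U$ (and $\infty$ if there is no such $j$). This does not depend on the choice of the basis. Theorem. The first fall degree of $s_0,\ldots,s_{n-1}$ is at most $m^2-m+1$, that is, $$D_{ff}\Big(\sum_{k=0}^{n-1}\mathbb{F}_2\,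 s_k\Big)\le m^2-m+1 \quad\text{and}\quad D_{ff}\Big(\sum_{k=0}^{n-1}\mathbb{F}_{2^n}\, s_k\Big)\le m^2-m+1,$$ with $K=\mathbb{F}_2$ and $K=\mathbb{F}_{2^n}$ in the definition of $D_{ff}$, respectively. -/

import Mathlib

open MvPolynomial

namespace FirstFall

noncomputable section

/-! ## The Boolean function ring and its associated graded ring -/

/-- The ring `A = K[X_i : i ∈ σ] / (X_i ^ 2 - X_i : i ∈ σ)`. -/
abbrev BoolRing (σ K : Type*) [Field K] : Type _ :=
  MvPolynomial σ K ⧸ Ideal.span (Set.range fun i : σ => (X i ^ 2 - X i : MvPolynomial σ K))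

/-- The canonical projection `K[X_i : i ∈ σ] → A`. -/
abbrev toBool (σ K : Type*) [Field K] : MvPolynomial σ K →ₐ[K] BoolRing σ K :=
  Ideal.Quotient.mkₐ K _

/-- The filtration component `[A]_d`: the classes of the polynomials of total degree at most `d`. -/
def boolFiltration (σ K : Type*) [Field K] (d : ℕ) : Submodule K (BoolRing σ K) :=
  (restrictTotalDegree σ K d).map (toBool σ K).toLinearMap

/-- The graded ring `S = Gr(A) = K[X_i : i ∈ σ] / (X_i ^ 2 : i ∈ σ)`. -/
abbrev GrRing (σ K : Type*) [Field K] : Type _ :=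
  MvPolynomial σ K ⧸ Ideal.span (Set.range fun i : σ => (X i ^ 2 : MvPolynomial σ K))

/-- The canonical projection `K[X_i : i ∈ σ] → S`. -/
abbrev toGr (σ K : Type*) [Field K] : MvPolynomial σ K →ₐ[K] GrRing σ K :=
  Ideal.Quotient.mkₐ K _

instance finite_grRing (σ K : Type*) [Finite σ] [Field K] : Module.Finite K (GrRing σ K) := by
  have key : ∀ p : MvPolynomial σ K, IsIntegral K (toGr σ K p) := by
    intro p
    induction p using MvPolynomial.induction_on with
    | C a => exact isIntegral_algebraMap (R := K) (A := GrRing σ K) (x := a)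
    | add p q hp hq => rw [map_add]; exact hp.add hq
    | mul_X p i hp =>
      rw [map_mul]
      refine hp.mul (IsIntegral.of_pow two_pos ?_)
      have h0 : toGr σ K (X i) ^ 2 = 0 := by
        rw [← map_pow]
        exact Ideal.Quotient.eq_zero_iff_mem.mpr (Ideal.subset_span ⟨i, rfl⟩)
      rw [h0]
      exact isIntegral_zero
  have : Algebra.IsIntegral K (GrRing σ K) :=
    ⟨fun x => by
      obtain ⟨p, rfl⟩ := Ideal.Quotient.mkₐ_surjective K _ x
      exact key p⟩
  have : Algebra.FiniteType K (GrRing σ K) :=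
    Algebra.FiniteType.of_surjective (toGr σ K) (Ideal.Quotient.mkₐ_surjective K _)
  exact Algebra.IsIntegral.finite

/-- The graded component `S_e`: the classes of the homogeneous polynomials of degree `e`. -/
def grComponent (σ K : Type*) [Field K] (e : ℕ) : Submodule K (GrRing σ K) :=
  (homogeneousSubmodule σ K e).map (toGr σ K).toLinearMap

/-- The image `π_d(V) ⊆ S_d` of `V ⊆ [A]_d` under the canonical projection
`π_d : [A]_d → [A]_d / [A]_{d-1} = S_d`. This projection sends the class in `A` of a polynomial `f`
of total degree at most `d` to the class in `S` of the homogeneous component of degree `d` of `f`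
(the latter class does not depend on the choice of `f`). -/
def leadingPart {σ K : Type*} [Field K] (d : ℕ) (V : Submodule K (BoolRing σ K)) :
    Submodule K (GrRing σ K) :=
  (V.comap (toBool σ K).toLinearMap ⊓ restrictTotalDegree σ K d).map
    ((toGr σ K).toLinearMap ∘ₗ homogeneousComponent d)

/-! ## The first fall degree (over fields of characteristic two) -/

/-- The submodule `U` of trivial relations between `h_1, …, h_r` in the free module `S ^ r`, generated
by `h_j e_i + h_i e_j` and `h_k e_k`. -/
def trivialRelations {σ K : Type*} [Field K] {r : ℕ} (h : Fin r → GrRing σ K) :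
    Submodule (GrRing σ K) (Fin r → GrRing σ K) :=
  Submodule.span (GrRing σ K)
    (Set.range (fun ij : Fin r × Fin r =>
        (Pi.single ij.1 (h ij.2) + Pi.single ij.2 (h ij.1) : Fin r → GrRing σ K)) ∪
      Set.range (fun k : Fin r => (Pi.single k (h k) : Fin r → GrRing σ K)))

/-- The map `S ^ r_e / U_e → S`, `(g_1, …, g_r) ↦ g_1 h_1 + ⋯ + g_r h_r`, is not injective:
some relation between `h_1, …, h_r` with homogeneous coefficients of degree `e` is not a
trivial one. -/
def HasNontrivialRelation {σ K : Type*} [Field K] {r : ℕ} (h : Fin r → GrRing σ K) (e : ℕ) : Prop :=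
  ∃ g : Fin r → GrRing σ K, (∀ i, g i ∈ grComponent σ K e) ∧ ∑ i, g i * h i = 0 ∧
    g ∉ trivialRelations h

/-- The first fall degree of a system `h_1, …, h_r` of linearly independent elements of `S_d`:
the smallest `j = d + e` such that `S ^ r_{j-d} / U_{j-d} → S_j` is not injective
(`⊤` if there is none). -/
def homogeneousFirstFallDegree {σ K : Type*} [Field K] (d : ℕ) {r : ℕ} (h : Fin r → GrRing σ K) :
    ℕ∞ :=
  sInf {j : ℕ∞ | ∃ e : ℕ, j = ((d + e : ℕ) : ℕ∞) ∧ HasNontrivialRelation h e}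

/-- The degree of a subspace `V` of `A`: the least `d` with `V ⊆ [A]_d`. -/
def filtrationDegree {σ K : Type*} [Field K] (V : Submodule K (BoolRing σ K)) : ℕ :=
  sInf {d : ℕ | V ≤ boolFiltration σ K d}

/-- The first fall degree of a subspace `V` of `A`. Let `d` be the degree of `V`, and `V'` its image in
`S_d`. If `dim V' < dim V`, it is `d`, otherwise it is the first fall degree of a basis of `V'`
(which does not depend on the choice of the basis). -/
def firstFallDegree {σ K : Type*} [Finite σ] [Field K] (V : Submodule K (BoolRing σ K)) : ℕ∞ :=
  if Module.finrank K (leadingPart (filtrationDegree V) V) < Module.finrank K V then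
    (filtrationDegree V : ℕ∞)
  else
    homogeneousFirstFallDegree (filtrationDegree V)
      (fun i => (Module.finBasis K (leadingPart (filtrationDegree V) V) i : GrRing σ K))

/-! ## Summation polynomials in characteristic two -/

/-- The third summation polynomial
`(x_1 ^ 2 + x_2 ^ 2) x_3 ^ 2 + x_1 x_2 x_3 + x_1 ^ 2 x_2 ^ 2 + a₆`, evaluated in a `K`-algebra. -/
def semaevThree {K R : Type*} [Field K] [CommRing R] [Algebra K R] (a₆ : K) (x₁ x₂ x₃ : R) : R :=
  (x₁ ^ 2 + x₂ ^ 2) * x₃ ^ 2 + x₁ * x₂ * x₃ + x₁ ^ 2 * x₂ ^ 2 + algebraMap K R a₆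

/-- The summation polynomials `S_m(x_1, …, x_m)`, `m ≥ 2`, of the elliptic curve
`y ^ 2 + x y = x ^ 3 + a₂ x ^ 2 + a₆` over a field `K` of characteristic two (they do not depend on
`a₂`), through the recursion
`S_{m+1}(x_1, …, x_{m+1}) = Res_X(S_m(x_1, …, x_{m-1}, X), S_3(x_m, x_{m+1}, X))` for `m ≥ 3`,
where the two polynomials in `X` have degrees `2 ^ (m - 2)` and `2`. Here `m = k + 3`, and the
variables are numbered from `0`. The values at `0` and `1` are not used. -/
def semaev {K : Type*} [Field K] (a₆ : K) : (m : ℕ) → MvPolynomial (Fin m) K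
  | 0 => 0
  | 1 => 0
  | 2 => X 0 - X 1
  | 3 => semaevThree a₆ (X 0) (X 1) (X 2)
  | k + 4 =>
      Polynomial.resultant
        (aeval (Fin.snoc (α := fun _ => Polynomial (MvPolynomial (Fin (k + 4)) K))
          (fun i : Fin (k + 2) => Polynomial.C (X (Fin.castAdd 2 i))) Polynomial.X)
          (semaev a₆ (k + 3)))
        (semaevThree a₆ (Polynomial.C (X (Fin.natAdd (k + 2) (0 : Fin 2))))
          (Polynomial.C (X (Fin.natAdd (k + 2) (1 : Fin 2)))) Polynomial.X)
        (2 ^ (k + 1)) 2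

/-! ## Weil descent -/

/-- `S_{m+1}(x_1, …, x_m, c)` with `x_i = ∑_l y_{il} ν_l`, a polynomial in the variables `y_{il}`. -/
def descentPolynomial {K : Type*} [Field K] (a₆ : K) {m n' : ℕ} (ν : Fin n' → K) (c : K) :
    MvPolynomial (Fin m × Fin n') K :=
  aeval (Fin.snoc (α := fun _ => MvPolynomial (Fin m × Fin n') K)
    (fun i : Fin m => ∑ l : Fin n', X (i, l) * C (ν l)) (C c)) (semaev a₆ (m + 1))

/-- The `k`-th coordinate polynomial over `F_2` of a polynomial over `K`, with respect to a basis `b`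
of `K` over `F_2`: the coordinate `b_k^*` is applied to every coefficient. -/
def coordPolynomial {K σ : Type*} [Field K] [Algebra (ZMod 2) K] {n : ℕ}
    (b : Module.Basis (Fin n) (ZMod 2) K) (k : Fin n) (p : MvPolynomial σ K) :
    MvPolynomial σ (ZMod 2) :=
  ∑ e ∈ p.support, monomial e (b.repr (coeff e p) k)

theorem coeff_coordPolynomial {K σ : Type*} [Field K] [Algebra (ZMod 2) K] {n : ℕ}
    (b : Module.Basis (Fin n) (ZMod 2) K) (k : Fin n) (p : MvPolynomial σ K) (e : σ →₀ ℕ) :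
    coeff e (coordPolynomial b k p) = b.repr (coeff e p) k := by
  classical
  simp only [coordPolynomial, coeff_sum, coeff_monomial, Finset.sum_ite_eq', mem_support_iff]
  split_ifs with h
  · rfl
  · rw [not_not.mp h]; simp

/-- The coordinate polynomials satisfy `p = f_0 b_0 + ⋯ + f_{n-1} b_{n-1}`. -/
theorem sum_coordPolynomial {K σ : Type*} [Field K] [Algebra (ZMod 2) K] {n : ℕ}
    (b : Module.Basis (Fin n) (ZMod 2) K) (p : MvPolynomial σ K) :
    ∑ k, C (b k) * MvPolynomial.map (algebraMap (ZMod 2) K) (coordPolynomial b k p) = p := by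
  ext e
  simp only [coeff_sum, coeff_C_mul, coeff_map, coeff_coordPolynomial]
  conv_rhs => rw [← b.sum_repr (coeff e p)]
  simp only [Algebra.smul_def, mul_comm]

/-- The coordinate polynomials `f_0, …, f_{n-1}` over `F_2` with
`S_{m+1}(x_1, …, x_m, c) = f_0 b_0 + ⋯ + f_{n-1} b_{n-1}` and `x_i = ∑_l y_{il} ν_l`. -/
def weilDescent {K : Type*} [Field K] [Algebra (ZMod 2) K] (a₆ : K) (m : ℕ) {n n' : ℕ}
    (b : Module.Basis (Fin n) (ZMod 2) K) (ν : Fin n' → K) (c : K) (k : Fin n) :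
    MvPolynomial (Fin m × Fin n') (ZMod 2) :=
  coordPolynomial b k (descentPolynomial a₆ ν c)

/-- The reduced system `s_0, …, s_{n-1}` over `F_2`, where `s_k` is the class of `f_k` modulo the
polynomials `y_{il} ^ 2 - y_{il}`. -/
def reducedSystem {K : Type*} [Field K] [Algebra (ZMod 2) K] (a₆ : K) (m : ℕ) {n n' : ℕ}
    (b : Module.Basis (Fin n) (ZMod 2) K) (ν : Fin n' → K) (c : K) (k : Fin n) :
    BoolRing (Fin m × Fin n') (ZMod 2) :=
  toBool _ _ (weilDescent a₆ m b ν c k)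

/-- The same system `s_0, …, s_{n-1}`, viewed over the extension field `K` of `F_2`. -/
def reducedSystemExt {K : Type*} [Field K] [Algebra (ZMod 2) K] (a₆ : K) (m : ℕ) {n n' : ℕ}
    (b : Module.Basis (Fin n) (ZMod 2) K) (ν : Fin n' → K) (c : K) (k : Fin n) :
    BoolRing (Fin m × Fin n') K :=
  toBool _ _ (MvPolynomial.map (algebraMap (ZMod 2) K) (weilDescent a₆ m b ν c k))

end

end FirstFall

namespace FirstFall

noncomputable section

universe u

/-! Put `N = 2 ^ (m - 1)`. In the Boolean ring `y ^ 2 = y`, so in characteristic two `x_i ^ (2 ^ j)`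
is the class of the linear form `L_ij = ∑_l ν_l ^ (2 ^ j) y_il`, and `x_i ^ a` is represented by a
product of as many linear forms as `a` has binary digits `1`. The summation polynomial has degree at
most `N` in each variable. An exponent `a ≤ N` has at most `m - 1` digits `1`, and since `m ≥ 3`
exactly `m - 1` of them only for `a = N - 1`. The descended polynomial is therefore represented in
degree at most `d = m (m - 1)`, and its part of degree `d` comes from the single monomial `(x_1 ⋯
x_m) ^ (N - 1)`.

The coefficient of that monomial is `c` (`hasTopShape_semaevAt`), so the leading form is `c ∏ L_ij`
over all `i` and all `j < m - 1` (`homogeneousComponent_linearizedSubst`). It is nonzero in the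
graded ring, because the `L_ij` are linearly independent (`linearIndependent_moore`,
`toGr_prod_frobeniusForm_ne_zero`). But `L_ij ^ 2 = 0` there, so each `L_ij` annihilates it.

This gives a relation with linear coefficients between leading forms of degree `d`. Trivial
relations have coefficients in degree at least `d ≥ 2`, so this one is nontrivial and the first fall
degree is at most `d + 1` (`firstFallDegree_le_succ`). Over `F_2` one takes a coordinate of the
relation with respect to the basis of the extension (`firstFallDegree_coord_le`). -/

/-! ### Resultants and degrees of the summation polynomials -/

theorem semaevThree_map {K R S : Type*} [Field K] [CommRing R] [CommRing S] [Algebra K R]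
    [Algebra K S] (f : R →ₐ[K] S) (a₆ : K) (x y z : R) :
    f (semaevThree a₆ x y z) = semaevThree a₆ (f x) (f y) (f z) := by
  simp [semaevThree]

/-- With its formal degrees fixed, the resultant is a determinant in the coefficients, so it
commutes with homomorphisms even when leading coefficients become zero. -/
theorem algHom_resultant {K R S : Type*} [Field K] [CommRing R] [CommRing S] [Algebra K R]
    [Algebra K S] (f : R →ₐ[K] S) (p q : Polynomial R) (m n : ℕ) :
    f (Polynomial.resultant p q m n) = Polynomial.resultant (Polynomial.mapAlgHom f p)
      (Polynomial.mapAlgHom f q) m n :=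
  (Polynomial.resultant_map_map p q m n f.toRingHom).symm

/-- Values of the summation polynomials satisfy the resultant recursion in every algebra. -/
theorem aeval_semaev_succ {K R : Type*} [Field K] [CommRing R] [Algebra K R] (a₆ : K) (k : ℕ)
    (v : Fin (k + 4) → R) :
    aeval v (semaev a₆ (k + 4)) = Polynomial.resultant
      (aeval (Fin.snoc (α := fun _ => Polynomial R)
          (fun i : Fin (k + 2) => Polynomial.C (v (Fin.castAdd 2 i))) Polynomial.X)
        (semaev a₆ (k + 3)))
      (semaevThree a₆ (Polynomial.C (v (Fin.natAdd (k + 2) (0 : Fin 2))))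
        (Polynomial.C (v (Fin.natAdd (k + 2) (1 : Fin 2)))) Polynomial.X)
      (2 ^ (k + 1)) 2 := by
  rw [semaev, algHom_resultant, semaevThree_map, ← AlgHom.comp_apply, comp_aeval]
  refine congrArg₂ (fun P Q => Polynomial.resultant P Q (2 ^ (k + 1)) 2) ?_ (by simp)
  congr 2
  funext i
  refine Fin.lastCases ?_ (fun i => ?_) i <;> simp

/-- Substituting constants for all variables but the last one gives a polynomial whose degree is
bounded by the degree in the last variable. -/
theorem natDegree_aeval_snoc_le {K R : Type*} [Field K] [CommRing R] [Algebra K R] {M N : ℕ}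
    (p : MvPolynomial (Fin (M + 1)) K) (hp : degreeOf (Fin.last M) p ≤ N) (w : Fin M → R) :
    (aeval (Fin.snoc (α := fun _ => Polynomial R)
      (fun i => Polynomial.C (w i)) Polynomial.X) p).natDegree ≤ N := by
  rw [aeval_def, eval₂_eq']
  refine Polynomial.natDegree_sum_le_of_forall_le _ _ fun e he => ?_
  rw [Fin.prod_univ_castSucc]
  simp only [Fin.snoc_castSucc, Fin.snoc_last, ← Polynomial.C_pow, ← map_prod]
  rw [← mul_assoc, IsScalarTower.algebraMap_apply K R (Polynomial R), Polynomial.algebraMap_apply,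
    ← Polynomial.C_mul]
  exact (Polynomial.natDegree_C_mul_X_pow_le _ _).trans
    ((le_degreeOf_of_mem_support _ he).trans hp)

/-- The determinant of a matrix has degree at most the sum of degree bounds of the columns. -/
theorem degreeOf_det_le {σ R : Type*} [CommRing R] {r : ℕ} (A : Matrix (Fin r) (Fin r)
    (MvPolynomial σ R)) (s : σ) (d : Fin r → ℕ) (h : ∀ i j, degreeOf s (A i j) ≤ d j) :
    degreeOf s A.det ≤ ∑ j, d j := by
  classical
  rw [Matrix.det_apply]
  refine (degreeOf_sum_le _ _ _).trans (Finset.sup_le fun τ _ => ?_)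
  have : degreeOf s (∏ i, A (τ i) i) ≤ ∑ j, d j :=
    (degreeOf_prod_le _ _ _).trans (Finset.sum_le_sum fun i _ => h _ _)
  rcases Int.units_eq_one_or (Equiv.Perm.sign τ) with h1 | h1 <;> simpa [h1] using this

/-- The Sylvester matrix has `M` columns of coefficients of `Q` and `N` columns of coefficients of
`P`. -/
theorem degreeOf_resultant_le {σ R : Type*} [CommRing R]
    (P Q : Polynomial (MvPolynomial σ R)) (s : σ) (M N p q : ℕ)
    (hP : ∀ j, degreeOf s (P.coeff j) ≤ p) (hQ : ∀ j, degreeOf s (Q.coeff j) ≤ q) :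
    degreeOf s (Polynomial.resultant P Q M N) ≤ M * q + N * p := by
  rw [Polynomial.resultant]
  refine (degreeOf_det_le _ s (fun j => Fin.addCases (fun _ => q) (fun _ => p) j) ?_).trans ?_
  · intro i j
    refine Fin.addCases (fun j => ?_) (fun j => ?_) j
    · simp only [Polynomial.sylvester, Matrix.of_apply, Fin.addCases_left]
      split_ifs
      · exact hQ _
      · simp
    · simp only [Polynomial.sylvester, Matrix.of_apply, Fin.addCases_right]
      split_ifs
      · exact hP _
      · simp
  · simp [Fin.sum_univ_add]

/-- Degrees do not grow when the variables are substituted by variables or constants. -/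
theorem degreeOf_coeff_aeval_snoc_le {K : Type*} [Field K] {M M' N : ℕ} (ι : Fin M ↪ Fin M')
    (p : MvPolynomial (Fin (M + 1)) K) (i : Fin M') (hp : ∀ j, degreeOf j p ≤ N) (j : ℕ) :
    degreeOf i ((aeval (Fin.snoc (α := fun _ => Polynomial (MvPolynomial (Fin M') K))
      (fun i => Polynomial.C (X (ι i))) Polynomial.X) p).coeff j) ≤
      if i ∈ Set.range ι then N else 0 := by
  classical
  rw [aeval_def, eval₂_eq', Polynomial.finsetSum_coeff]
  refine (degreeOf_sum_le _ _ _).trans (Finset.sup_le fun e he => ?_)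
  rw [Fin.prod_univ_castSucc]
  simp only [Fin.snoc_castSucc, Fin.snoc_last, ← Polynomial.C_pow, ← map_prod]
  rw [← mul_assoc, IsScalarTower.algebraMap_apply K (MvPolynomial (Fin M') K) (Polynomial _),
    Polynomial.algebraMap_apply, ← Polynomial.C_mul, Polynomial.coeff_C_mul_X_pow]
  split_ifs with h1 h2 h2
  · obtain ⟨i, rfl⟩ := h2
    refine (degreeOf_C_mul_le _ _ _).trans ((degreeOf_prod_le _ _ _).trans ?_)
    refine le_trans (Finset.sum_le_sum (g := fun l => if l = i then N else 0) fun l _ => ?_) ?_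
    · split_ifs with hl
      · subst hl
        refine (degreeOf_pow_le _ _ _).trans ?_
        rw [degreeOf_X_self, mul_one]
        exact (le_degreeOf_of_mem_support _ he).trans (hp _)
      · refine (degreeOf_pow_le _ _ _).trans ?_
        rw [degreeOf_X_of_ne (fun h => hl (ι.injective h).symm), mul_zero]
    · simp
  · refine (degreeOf_C_mul_le _ _ _).trans ((degreeOf_prod_le _ _ _).trans ?_)
    refine (Finset.sum_eq_zero fun l _ => ?_).le
    refine Nat.le_zero.mp ((degreeOf_pow_le _ _ _).trans ?_)
    rw [degreeOf_X_of_ne (fun h => h2 ⟨l, h.symm⟩), mul_zero]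
  · simp
  · simp

theorem degreeOf_coeff_semaevThree_le {K σ : Type*} [Field K] (a₆ : K) (y₁ y₂ : MvPolynomial σ K)
    (i : σ) {u w : ℕ} (hu : degreeOf i y₁ ≤ u) (hw : degreeOf i y₂ ≤ w) (j : ℕ) :
    degreeOf i ((semaevThree a₆ (Polynomial.C y₁) (Polynomial.C y₂) Polynomial.X).coeff j) ≤
      2 * u + 2 * w := by
  have hq : semaevThree a₆ (Polynomial.C y₁) (Polynomial.C y₂) Polynomial.X =
      Polynomial.C (y₁ ^ 2 + y₂ ^ 2) * Polynomial.X ^ 2 +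
      Polynomial.C (y₁ * y₂) * Polynomial.X + Polynomial.C (y₁ ^ 2 * y₂ ^ 2 + C a₆) := by
    rw [semaevThree, IsScalarTower.algebraMap_apply K (MvPolynomial σ K),
      Polynomial.algebraMap_apply, MvPolynomial.algebraMap_eq, Algebra.algebraMap_self]
    simp only [map_add, map_mul, map_pow, RingHom.id_apply]
    ring
  have hu2 : degreeOf i (y₁ ^ 2) ≤ 2 * u := (degreeOf_pow_le _ _ _).trans (by omega)
  have hw2 : degreeOf i (y₂ ^ 2) ≤ 2 * w := (degreeOf_pow_le _ _ _).trans (by omega)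
  have hA : degreeOf i (y₁ ^ 2 + y₂ ^ 2) ≤ 2 * u + 2 * w :=
    (degreeOf_add_le _ _ _).trans (max_le (by omega) (by omega))
  have hB : degreeOf i (y₁ * y₂) ≤ 2 * u + 2 * w :=
    (degreeOf_mul_le _ _ _).trans (by omega)
  have hC : degreeOf i (y₁ ^ 2 * y₂ ^ 2 + C a₆) ≤ 2 * u + 2 * w :=
    (degreeOf_add_le _ _ _).trans (max_le ((degreeOf_mul_le _ _ _).trans (by omega))
      (by simp))
  have h0 : degreeOf i (0 : MvPolynomial σ K) ≤ 2 * u + 2 * w := by simp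
  rw [hq, Polynomial.coeff_add, Polynomial.coeff_add, Polynomial.coeff_C_mul_X_pow,
    Polynomial.coeff_C_mul_X, Polynomial.coeff_C]
  refine (degreeOf_add_le _ _ _).trans (max_le ((degreeOf_add_le _ _ _).trans
    (max_le ?_ ?_)) ?_)
  · split_ifs
    exacts [hA, h0]
  · split_ifs
    exacts [hB, h0]
  · split_ifs
    exacts [hC, h0]

/-- The summation polynomial `S_m` has degree at most `2 ^ (m - 2)` in every variable. -/
theorem degreeOf_semaev_le {K : Type*} [Field K] (a₆ : K) (k : ℕ) (i : Fin (k + 3)) :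
    degreeOf i (semaev a₆ (k + 3)) ≤ 2 ^ (k + 1) := by
  induction k with
  | zero =>
    have hX : ∀ j : Fin 3, degreeOf i (X j : MvPolynomial (Fin 3) K) = if j = i then 1 else 0 := by
      intro j
      split_ifs with h
      · rw [h, degreeOf_X_self]
      · exact degreeOf_X_of_ne (Ne.symm h)
    have hX2 : ∀ j : Fin 3, degreeOf i (X j ^ 2 : MvPolynomial (Fin 3) K) ≤
        if j = i then 2 else 0 := fun j =>
      (degreeOf_pow_le _ _ _).trans (by rw [hX]; split_ifs <;> simp)
    have hs : degreeOf i (X 0 ^ 2 + X 1 ^ 2 : MvPolynomial (Fin 3) K) ≤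
        max (if (0 : Fin 3) = i then 2 else 0) (if (1 : Fin 3) = i then 2 else 0) :=
      (degreeOf_add_le _ _ _).trans (max_le_max (hX2 0) (hX2 1))
    have h0 := hX 0
    have h1 := hX 1
    have h2 := hX 2
    have h0' := hX2 0
    have h1' := hX2 1
    have h2' := hX2 2
    have m1 := degreeOf_mul_le i (X 0 ^ 2 + X 1 ^ 2 : MvPolynomial (Fin 3) K) (X 2 ^ 2)
    have m2 := degreeOf_mul_le i (X 0 : MvPolynomial (Fin 3) K) (X 1)
    have m3 := degreeOf_mul_le i (X 0 * X 1 : MvPolynomial (Fin 3) K) (X 2)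
    have m4 := degreeOf_mul_le i (X 0 ^ 2 : MvPolynomial (Fin 3) K) (X 1 ^ 2)
    have m5 : degreeOf i (algebraMap K (MvPolynomial (Fin 3) K) a₆) = 0 := degreeOf_C _ _
    change degreeOf i (semaevThree a₆ (X 0) (X 1) (X 2)) ≤ 2
    rw [semaevThree]
    refine (degreeOf_add_le _ _ _).trans (max_le ((degreeOf_add_le _ _ _).trans (max_le
      ((degreeOf_add_le _ _ _).trans (max_le ?_ ?_)) ?_)) ?_)
    all_goals fin_cases i <;> simp at * <;> omega
  | succ k ih =>
    have hX : ∀ j : Fin (k + 4), degreeOf i (X j : MvPolynomial (Fin (k + 4)) K) ≤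
        if j = i then 1 else 0 := by
      intro j
      split_ifs with h
      · rw [h, degreeOf_X_self]
      · exact (degreeOf_X_of_ne (Ne.symm h)).le
    rw [semaev]
    -- Each variable occurs in only one of the two polynomials: the first `k + 2` only in the
    -- previous summation polynomial (contribution `2 * 2 ^ (k + 1)`), the last two only in `S_3`
    -- (contribution `2 ^ (k + 1) * 2`).
    refine (degreeOf_resultant_le _ _ i (2 ^ (k + 1)) 2
      (if i ∈ Set.range (Fin.castAddEmb 2) then 2 ^ (k + 1) else 0) _
      (degreeOf_coeff_aeval_snoc_le (Fin.castAddEmb 2) _ i ih)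
      (degreeOf_coeff_semaevThree_le a₆ _ _ i (hX _) (hX _))).trans ?_
    refine Fin.addCases (m := k + 2) (n := 2) (fun l => ?_) (fun l => ?_) i
    · have h1 : Fin.natAdd (k + 2) (0 : Fin 2) ≠ Fin.castAdd 2 l := by
        intro h; have := congrArg Fin.val h; simp at this; omega
      have h2 : Fin.natAdd (k + 2) (1 : Fin 2) ≠ Fin.castAdd 2 l := by
        intro h; have := congrArg Fin.val h; simp at this; omega
      rw [if_neg h1, if_neg h2]
      split_ifs <;> simp [pow_succ, mul_comm]
    · have h : Fin.natAdd (k + 2) l ∉ Set.range (Fin.castAddEmb 2 : Fin (k + 2) ↪ Fin (k + 4)) := by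
        rintro ⟨l', h⟩
        have := congrArg Fin.val h
        simp at this
        omega
      rw [if_neg h]
      fin_cases l <;> simp [pow_succ]

/-! ### The highest coefficients of the summation polynomials -/

/-- The summation polynomial `S_{M+1}(x_1, …, x_M, c)` over an extension `L` of `K`. -/
def semaevAt {K L : Type*} [Field K] [Field L] [Algebra K L] (a₆ : K) (M : ℕ) (c : L) :
    MvPolynomial (Fin M) L :=
  aeval (Fin.snoc (α := fun _ => MvPolynomial (Fin M) L) X (C c)) (semaev a₆ (M + 1))

theorem degreeOf_semaevAt_le {K L : Type*} [Field K] [Field L] [Algebra K L] (a₆ : K) (k : ℕ)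
    (c : L) (i : Fin (k + 2)) : degreeOf i (semaevAt a₆ (k + 2) c) ≤ 2 ^ (k + 1) := by
  classical
  rw [semaevAt, aeval_def, eval₂_eq']
  refine (degreeOf_sum_le _ _ _).trans (Finset.sup_le fun e he => ?_)
  rw [Fin.prod_univ_castSucc]
  simp only [Fin.snoc_castSucc, Fin.snoc_last, ← C_pow]
  rw [IsScalarTower.algebraMap_apply K L (MvPolynomial (Fin (k + 2)) L), MvPolynomial.algebraMap_eq]
  refine (degreeOf_C_mul_le _ _ _).trans ((degreeOf_mul_le _ _ _).trans ?_)
  rw [degreeOf_C, add_zero]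
  refine (degreeOf_prod_le _ _ _).trans ?_
  refine le_trans (Finset.sum_le_sum (g := fun l => if l = i then 2 ^ (k + 1) else 0)
    fun l _ => ?_) (by simp)
  refine (degreeOf_pow_le _ _ _).trans ?_
  split_ifs with hl
  · subst hl
    rw [degreeOf_X_self, mul_one]
    exact (le_degreeOf_of_mem_support _ he).trans (degreeOf_semaev_le a₆ k _)
  · rw [degreeOf_X_of_ne (Ne.symm hl), mul_zero]

/-- The exponent vector which is `N` on `T` and `N - 1` outside `T`. -/
def topExp {M : ℕ} (N : ℕ) (T : Finset (Fin M)) : Fin M →₀ ℕ :=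
  Finsupp.equivFunOnFinite.symm fun i => if i ∈ T then N else N - 1

theorem topExp_apply {M : ℕ} (N : ℕ) (T : Finset (Fin M)) (i : Fin M) :
    topExp N T i = if i ∈ T then N else N - 1 := rfl

/-- The shape of the coefficients of the highest monomials of a summation polynomial. -/
structure HasTopShape {M : ℕ} {L : Type*} [Field L] (N : ℕ) (p : MvPolynomial (Fin M) L) (c : L) :
    Prop where
  degreeOf_le : ∀ i, degreeOf i p ≤ N
  coeff_univ : coeff (topExp N Finset.univ) p = 1
  coeff_empty : coeff (topExp N ∅) p = c
  coeff_ne : ∀ T : Finset (Fin M), T ≠ Finset.univ → T ≠ ∅ → coeff (topExp N T) p = 0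

/-- Every exponent is squeezed between `N - 1` and `N`, so `e` is `topExp N T` for the set `T` where
it equals `N`. -/
theorem HasTopShape.eq_of_coeff_ne_zero {M : ℕ} {L : Type*} [Field L] {N : ℕ}
    {p : MvPolynomial (Fin M) L} {c : L} (h : HasTopShape N p c) {e : Fin M →₀ ℕ}
    (he : ∀ i, N - 1 ≤ e i) (h0 : coeff e p ≠ 0) :
    e = topExp N Finset.univ ∨ e = topExp N ∅ := by
  classical
  have hT : e = topExp N (Finset.univ.filter fun i => e i = N) := by
    ext i
    have h1 := (le_degreeOf_of_mem_support i (mem_support_iff.mpr h0)).trans (h.degreeOf_le i)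
    have h2 := he i
    rw [topExp_apply]
    simp only [Finset.mem_filter_univ]
    split_ifs <;> omega
  by_cases h1 : (Finset.univ.filter fun i => e i = N) = Finset.univ
  · left; rwa [h1] at hT
  by_cases h2 : (Finset.univ.filter fun i => e i = N) = ∅
  · right; rwa [h2] at hT
  · exact absurd (hT ▸ h.coeff_ne _ h1 h2) h0

/-- A factor has exponents at most `N`, so a total exponent of at least `2 * N - 1` forces both to
be at least `N - 1`. Each factor then contributes only its all-`N` or its all-`(N - 1)` monomial.
The two mixed products give `c + d`; two all-`(N - 1)` monomials give exponents `2 * N - 2`, too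
small to matter. For `M = 0` the two monomials would coincide. -/
theorem HasTopShape.mul {M : ℕ} [NeZero M] {L : Type*} [Field L] {N : ℕ} (hN : 0 < N)
    {p q : MvPolynomial (Fin M) L} {c d : L} (hp : HasTopShape N p c) (hq : HasTopShape N q d) :
    HasTopShape (2 * N) (p * q) (c + d) := by
  classical
  have key : ∀ T : Finset (Fin M), ∀ x ∈ Finset.HasAntidiagonal.antidiagonal (topExp (2 * N) T),
      coeff x.1 p * coeff x.2 q ≠ 0 → (x.1 = topExp N Finset.univ ∨ x.1 = topExp N ∅) ∧
        (x.2 = topExp N Finset.univ ∨ x.2 = topExp N ∅) := by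
    intro T x hx h0
    have h1 := left_ne_zero_of_mul h0
    have h2 := right_ne_zero_of_mul h0
    have hs : ∀ i, N - 1 ≤ x.1 i ∧ N - 1 ≤ x.2 i := by
      intro i
      have e1 := (le_degreeOf_of_mem_support i (mem_support_iff.mpr h1)).trans (hp.degreeOf_le i)
      have e2 := (le_degreeOf_of_mem_support i (mem_support_iff.mpr h2)).trans (hq.degreeOf_le i)
      have e3 := DFunLike.congr_fun (Finset.HasAntidiagonal.mem_antidiagonal.mp hx) i
      rw [Finsupp.add_apply, topExp_apply] at e3
      split_ifs at e3 <;> omega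
    exact ⟨hp.eq_of_coeff_ne_zero (fun i => (hs i).1) h1,
      hq.eq_of_coeff_ne_zero (fun i => (hs i).2) h2⟩
  have huu : topExp N (Finset.univ : Finset (Fin M)) + topExp N Finset.univ =
      topExp (2 * N) Finset.univ := by
    ext i; simp [topExp_apply]; omega
  have hue : topExp N (Finset.univ : Finset (Fin M)) + topExp N ∅ = topExp (2 * N) ∅ := by
    ext i; simp [topExp_apply]; omega
  have heu : topExp N ∅ + topExp N (Finset.univ : Finset (Fin M)) = topExp (2 * N) ∅ := by
    rw [add_comm, hue]
  have hne : topExp N (Finset.univ : Finset (Fin M)) ≠ topExp N ∅ := by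
    intro h
    have := DFunLike.congr_fun h 0
    simp [topExp_apply] at this
    omega
  have hval : ∀ T : Finset (Fin M), (topExp (2 * N) T) 0 = 2 * N ∨
      (topExp (2 * N) T) 0 = 2 * N - 1 := by
    intro T; rw [topExp_apply]; split_ifs <;> simp
  have hee : ∀ T : Finset (Fin M), topExp N ∅ + topExp N ∅ ≠ topExp (2 * N) T := by
    intro T h
    have := DFunLike.congr_fun h 0
    have h2 := hval T
    simp only [Finsupp.add_apply] at this
    simp only [topExp_apply, Finset.notMem_empty, if_false] at this h2
    omega
  have hinj : ∀ T T' : Finset (Fin M), topExp (2 * N) T = topExp (2 * N) T' → T = T' := by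
    intro T T' h
    ext i
    have := DFunLike.congr_fun h i
    rw [topExp_apply, topExp_apply] at this
    split_ifs at this with h1 h2 h2 <;> first | omega | simp [h1, h2]
  refine ⟨fun i => ?_, ?_, ?_, fun T h1 h2 => ?_⟩
  · have := degreeOf_mul_le i p q
    have := hp.degreeOf_le i
    have := hq.degreeOf_le i
    omega
  · rw [coeff_mul, Finset.sum_eq_single (topExp N Finset.univ, topExp N Finset.univ)]
    · rw [hp.coeff_univ, hq.coeff_univ, one_mul]
    · intro x hx hne'
      by_contra h0
      have hs := Finset.HasAntidiagonal.mem_antidiagonal.mp hx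
      obtain ⟨h1 | h1, h2 | h2⟩ := key _ x hx h0
      · exact hne' (Prod.ext h1 h2)
      · rw [h1, h2, hue] at hs
        exact Finset.univ_nonempty.ne_empty (hinj _ _ hs).symm
      · rw [h1, h2, heu] at hs
        exact Finset.univ_nonempty.ne_empty (hinj _ _ hs).symm
      · rw [h1, h2] at hs
        exact hee _ hs
    · intro h; exact absurd (Finset.HasAntidiagonal.mem_antidiagonal.mpr huu) h
  · have hsub : ({(topExp N Finset.univ, topExp N ∅), (topExp N ∅, topExp N Finset.univ)} :
        Finset ((Fin M →₀ ℕ) × (Fin M →₀ ℕ))) ⊆ Finset.HasAntidiagonal.antidiagonal (topExp (2 * N) ∅) := by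
      intro x hx
      rw [Finset.mem_insert, Finset.mem_singleton] at hx
      rcases hx with rfl | rfl
      · exact Finset.HasAntidiagonal.mem_antidiagonal.mpr hue
      · exact Finset.HasAntidiagonal.mem_antidiagonal.mpr heu
    rw [coeff_mul, ← Finset.sum_subset hsub, Finset.sum_pair]
    · simp [hp.coeff_univ, hq.coeff_univ, hp.coeff_empty, hq.coeff_empty, add_comm]
    · exact fun h => hne (congrArg Prod.fst h)
    · intro x hx hx'
      by_contra h0
      have hs := Finset.HasAntidiagonal.mem_antidiagonal.mp hx
      obtain ⟨h1 | h1, h2 | h2⟩ := key _ x hx h0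
      · rw [h1, h2, huu] at hs
        exact Finset.univ_nonempty.ne_empty (hinj _ _ hs)
      · exact hx' (by simp [Prod.ext_iff, h1, h2])
      · exact hx' (by simp [Prod.ext_iff, h1, h2])
      · rw [h1, h2] at hs
        exact hee _ hs
  · rw [coeff_mul]
    refine Finset.sum_eq_zero fun x hx => ?_
    by_contra h0
    have hs := Finset.HasAntidiagonal.mem_antidiagonal.mp hx
    obtain ⟨h3 | h3, h4 | h4⟩ := key _ x hx h0
    · rw [h3, h4, huu] at hs
      exact h1 (hinj _ _ hs).symm
    · rw [h3, h4, hue] at hs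
      exact h2 (hinj _ _ hs).symm
    · rw [h3, h4, heu] at hs
      exact h2 (hinj _ _ hs).symm
    · rw [h3, h4] at hs
      exact hee _ hs

/-- The map `L[x_1, …, x_{M+1}] → L[t][x_1, …, x_M]` sending the last variable to
the coefficient `t`. -/
def splitLast (L : Type*) [Field L] (M : ℕ) :
    MvPolynomial (Fin (M + 1)) L →ₐ[L] MvPolynomial (Fin M) (Polynomial L) :=
  aeval (Fin.snoc (α := fun _ => MvPolynomial (Fin M) (Polynomial L)) X (C Polynomial.X))

theorem coeff_splitLast {L : Type*} [Field L] {M : ℕ} (p : MvPolynomial (Fin (M + 1)) L)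
    (e : Fin (M + 1) →₀ ℕ) :
    (coeff (Finsupp.equivFunOnFinite.symm fun i : Fin M => e i.castSucc)
      (splitLast L M p)).coeff (e (Fin.last M)) = coeff e p := by
  classical
  induction p using MvPolynomial.induction_on' with
  | add p q hp hq => rw [map_add, coeff_add, Polynomial.coeff_add, hp, hq, coeff_add]
  | monomial s a =>
    have h : splitLast L M (monomial s a) =
        monomial (Finsupp.equivFunOnFinite.symm fun i : Fin M => s i.castSucc)
          (Polynomial.monomial (s (Fin.last M)) a) := by
      rw [splitLast, aeval_monomial, Finsupp.prod_fintype _ _ (by simp), Fin.prod_univ_castSucc,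
        monomial_eq, Finsupp.prod_fintype _ _ (by simp), ← Polynomial.C_mul_X_pow_eq_monomial,
        C_mul, C_pow, IsScalarTower.algebraMap_apply L (Polynomial L), Polynomial.algebraMap_apply,
        MvPolynomial.algebraMap_eq]
      simp only [Fin.snoc_castSucc, Fin.snoc_last, Algebra.algebraMap_self, RingHom.id_apply,
        Finsupp.equivFunOnFinite_symm_apply_apply]
      ring
    rw [h, coeff_monomial, coeff_monomial]
    by_cases hs : s = e
    · subst hs; simp
    · rw [if_neg hs]
      split_ifs with h1
      · rw [Polynomial.coeff_monomial, if_neg]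
        intro h2
        apply hs
        ext i
        refine Fin.lastCases h2 (fun i => ?_) i
        exact DFunLike.congr_fun h1 i
      · simp

/-- The resultant is multiplicative in the second polynomial, and against `X - r` it is the value at
`r` up to a sign, which disappears in characteristic two. -/
theorem resultant_quadratic {R : Type*} [CommRing R] [CharP R 2] [Nontrivial R] (P : Polynomial R)
    (m : ℕ) (hP : P.natDegree ≤ m) (a r s : R) :
    Polynomial.resultant P (Polynomial.C a * ((Polynomial.X - Polynomial.C r) *
      (Polynomial.X - Polynomial.C s))) m 2 = a ^ m * (P.eval r * P.eval s) := by
  have h := Polynomial.resultant_mul_right P (Polynomial.X - Polynomial.C r)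
    (Polynomial.X - Polynomial.C s) m hP
  rw [Polynomial.natDegree_X_sub_C, Polynomial.natDegree_X_sub_C,
    Polynomial.resultant_X_sub_C_right _ _ _ hP, Polynomial.resultant_X_sub_C_right _ _ _ hP,
    CharTwo.neg_eq, one_pow, one_mul, one_mul] at h
  rw [Polynomial.resultant_C_mul_right, h]

/-- The quadratic polynomial `S_3(t, c, X)` splits over an algebraically closed field. -/
theorem exists_semaevThree_eq {K Ω : Type*} [Field K] [Field Ω] [Algebra K Ω] [CharP Ω 2]
    [IsAlgClosed Ω] (a₆ : K) (t c : Ω) (ha : t ^ 2 + c ^ 2 ≠ 0) :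
    ∃ r s : Ω, (t ^ 2 + c ^ 2) * (r + s) = t * c ∧
      ∀ (R : Type _) [CommRing R] [Algebra K R] [Algebra Ω R] [IsScalarTower K Ω R] (x : R),
        semaevThree a₆ (algebraMap Ω R t) (algebraMap Ω R c) x =
          algebraMap Ω R (t ^ 2 + c ^ 2) * ((x - algebraMap Ω R r) * (x - algebraMap Ω R s)) := by
  set a := t ^ 2 + c ^ 2 with haa
  set e := t ^ 2 * c ^ 2 + algebraMap K Ω a₆ with hee
  obtain ⟨r, hr⟩ := IsAlgClosed.exists_root
    (Polynomial.C a * Polynomial.X ^ 2 + Polynomial.C (t * c) * Polynomial.X + Polynomial.C e)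
    (by rw [Polynomial.degree_quadratic ha]; decide)
  simp only [Polynomial.IsRoot.def, Polynomial.eval_add, Polynomial.eval_mul, Polynomial.eval_C,
    Polynomial.eval_pow, Polynomial.eval_X] at hr
  have h2 : (2 : Ω) = 0 := CharTwo.two_eq_zero
  -- The roots sum to `t * c / a`, so in characteristic two the second root is `t * c / a + r`.
  have hs : a * (r + (t * c / a + r)) = t * c := by
    field_simp
    linear_combination a * r * h2
  have hprod : a * (r * (t * c / a + r)) = e := by
    have : a * (t * c / a) = t * c := by field_simp
    linear_combination hr + r * this - e * h2
  refine ⟨r, t * c / a + r, hs, ?_⟩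
  intro R _ _ _ _ x
  have hs' := congrArg (algebraMap Ω R) hs
  have hp' := congrArg (algebraMap Ω R) hprod
  have h2' : (2 : R) = 0 := by
    rw [← map_ofNat (algebraMap Ω R) 2, h2, map_zero]
  rw [hee, map_add (algebraMap Ω R) (t ^ 2 * c ^ 2), ← IsScalarTower.algebraMap_apply K Ω R] at hp'
  generalize t * c / a + r = s at *
  simp only [haa, map_add, map_mul, map_pow] at hs' hp' ⊢
  rw [semaevThree]
  linear_combination x * hs' - hp' + x * algebraMap Ω R t * algebraMap Ω R c * h2'

theorem eval_aeval_snoc {K Ω : Type*} [Field K] [Field Ω] [Algebra K Ω] (a₆ : K) (M : ℕ) (r : Ω) :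
    (aeval (Fin.snoc (α := fun _ => Polynomial (MvPolynomial (Fin M) Ω))
      (fun i : Fin M => Polynomial.C (X i)) Polynomial.X) (semaev a₆ (M + 1))).eval (C r) =
      semaevAt a₆ M r := by
  have h : ∀ p : Polynomial (MvPolynomial (Fin M) Ω), p.eval (C r) =
      ((Polynomial.aeval (C r : MvPolynomial (Fin M) Ω)).restrictScalars K) p := by
    intro p; simp
  rw [h, ← AlgHom.comp_apply, comp_aeval, semaevAt]
  congr 2
  funext i
  refine Fin.lastCases ?_ (fun i => ?_) i <;> simp

/-- With `x_m = t` and `x_{m+1} = c` specialised in an algebraically closed field, `S_{m+1}` factors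
into two values of `S_m`. -/
theorem aeval_semaev_eq_mul {K Ω : Type*} [Field K] [Field Ω] [Algebra K Ω] [CharP Ω 2]
    [IsAlgClosed Ω] (a₆ : K) (k : ℕ) (t c : Ω) (ha : t ^ 2 + c ^ 2 ≠ 0)
    (v : Fin (k + 4) → MvPolynomial (Fin (k + 2)) Ω) (hv : ∀ i, v (Fin.castAdd 2 i) = X i)
    (hv0 : v (Fin.natAdd (k + 2) (0 : Fin 2)) = C t)
    (hv1 : v (Fin.natAdd (k + 2) (1 : Fin 2)) = C c) :
    ∃ r s : Ω, (t ^ 2 + c ^ 2) * (r + s) = t * c ∧ aeval v (semaev a₆ (k + 4)) =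
      C ((t ^ 2 + c ^ 2) ^ 2 ^ (k + 1)) * (semaevAt a₆ (k + 2) r * semaevAt a₆ (k + 2) s) := by
  obtain ⟨r, s, hrs, h⟩ := exists_semaevThree_eq a₆ t c ha
  refine ⟨r, s, hrs, ?_⟩
  rw [aeval_semaev_succ, ← eval_aeval_snoc, ← eval_aeval_snoc, C_pow]
  rw [← resultant_quadratic _ _ (natDegree_aeval_snoc_le _ (degreeOf_semaev_le a₆ k _) _),
    hv0, hv1]
  have hC : (fun i => Polynomial.C (v (Fin.castAdd 2 i))) = fun i => Polynomial.C (X i) :=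
    funext fun i => by rw [hv]
  refine congrArg₂ (fun P Q => Polynomial.resultant P Q (2 ^ (k + 1)) 2) (by rw [hC]) ?_
  exact h (Polynomial (MvPolynomial (Fin (k + 2)) Ω)) Polynomial.X

theorem semaevAt_two {K L : Type*} [Field K] [Field L] [Algebra K L] (a₆ : K) (c : L) :
    semaevAt a₆ 2 c = monomial (Finsupp.equivFunOnFinite.symm ![2, 0]) (c ^ 2) +
      monomial (Finsupp.equivFunOnFinite.symm ![0, 2]) (c ^ 2) +
      monomial (Finsupp.equivFunOnFinite.symm ![1, 1]) c +
      monomial (Finsupp.equivFunOnFinite.symm ![2, 2]) 1 +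
      monomial (Finsupp.equivFunOnFinite.symm ![0, 0]) (algebraMap K L a₆) := by
  have h : semaevAt a₆ 2 c =
      semaevThree a₆ (X 0 : MvPolynomial (Fin 2) L) (X 1) (C c) := by
    rw [semaevAt, semaev, semaevThree_map, aeval_X, aeval_X, aeval_X]
    rfl
  rw [h, semaevThree, IsScalarTower.algebraMap_apply K L (MvPolynomial (Fin 2) L),
    MvPolynomial.algebraMap_eq]
  have hm : ∀ (i j : ℕ) (u : L), monomial (Finsupp.equivFunOnFinite.symm ![i, j]) u =
      C u * (X 0 ^ i * X 1 ^ j) := by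
    intro i j u
    rw [monomial_eq, Finsupp.prod_fintype _ _ (fun i => by simp), Fin.prod_univ_two]
    rfl
  simp only [hm, map_pow, map_one]
  ring

/-- In `S_3(x_1, x_2, c) = x_1² x_2² + c x_1 x_2 + c² (x_1² + x_2²) + a₆` the mixed monomials `x_1²
x_2` and `x_1 x_2²` are absent. -/
theorem hasTopShape_semaevAt_two {K L : Type*} [Field K] [Field L] [Algebra K L] (a₆ : K) (c : L) :
    HasTopShape 2 (semaevAt a₆ 2 c) c := by
  classical
  refine ⟨fun i => degreeOf_semaevAt_le a₆ 0 c i, ?_, ?_, fun T h1 h2 => ?_⟩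
  · simp only [semaevAt_two, coeff_add, coeff_monomial, topExp, EmbeddingLike.apply_eq_iff_eq]
    simp [funext_iff, Fin.forall_fin_two]
  · simp only [semaevAt_two, coeff_add, coeff_monomial, topExp, EmbeddingLike.apply_eq_iff_eq]
    simp [funext_iff, Fin.forall_fin_two]
  · have hT : (0 ∈ T ∧ 1 ∉ T) ∨ (0 ∉ T ∧ 1 ∈ T) := by
      revert T; decide
    simp only [semaevAt_two, coeff_add, coeff_monomial, topExp, EmbeddingLike.apply_eq_iff_eq]
    rcases hT with ⟨h, h'⟩ | ⟨h, h'⟩ <;> simp [funext_iff, Fin.forall_fin_two, h, h']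

/-- The last variable `t` is read off the coefficients. By Frobenius the first hypothesis is `t ^ (2
^ N) + c ^ (2 ^ N)`, with coefficient `1` at `2 ^ N` and `0` at `2 ^ N - 1`. The second polynomial
has degree at most `2 ^ N - 1`, where its coefficient is `c`. -/
theorem HasTopShape.of_splitLast {L : Type*} [Field L] {M N : ℕ} (hN : 0 < N)
    [CharP L 2] {p : MvPolynomial (Fin (M + 1)) L} {c : L} (hp : ∀ i, degreeOf i p ≤ 2 ^ N)
    (hu : coeff (topExp (2 ^ N) Finset.univ) (splitLast L M p) =
      (Polynomial.X ^ 2 + Polynomial.C c ^ 2) ^ 2 ^ (N - 1))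
    (he : coeff (topExp (2 ^ N) ∅) (splitLast L M p) =
      (Polynomial.X ^ 2 + Polynomial.C c ^ 2) ^ (2 ^ (N - 1) - 1) *
        (Polynomial.X * Polynomial.C c))
    (hn : ∀ T : Finset (Fin M), T ≠ Finset.univ → T ≠ ∅ →
      coeff (topExp (2 ^ N) T) (splitLast L M p) = 0) : HasTopShape (2 ^ N) p c := by
  classical
  have hN2 : 2 ^ N = 2 * 2 ^ (N - 1) := by
    rw [← pow_succ', Nat.sub_add_cancel hN]
  have hN1 : 0 < 2 ^ (N - 1) := by positivity
  have hc : ∀ T : Finset (Fin (M + 1)), coeff (topExp (2 ^ N) T) p =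
      (coeff (topExp (2 ^ N) (Finset.univ.filter fun i : Fin M => i.castSucc ∈ T))
        (splitLast L M p)).coeff (topExp (2 ^ N) T (Fin.last M)) := by
    intro T
    rw [← coeff_splitLast]
    congr 2
    ext i
    simp [topExp_apply]
  have hpu : ((Polynomial.X ^ 2 + Polynomial.C c ^ 2 : Polynomial L) ^ 2 ^ (N - 1)) =
      Polynomial.X ^ 2 ^ N + Polynomial.C (c ^ 2 ^ N) := by
    rw [add_pow_char_pow (p := 2), ← pow_mul, ← pow_mul, ← hN2, Polynomial.C_pow]
  have hmon : ((Polynomial.X ^ 2 + Polynomial.C c ^ 2) ^ (2 ^ (N - 1) - 1) : Polynomial L).natDegree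
      = 2 ^ N - 2 ∧
      ((Polynomial.X ^ 2 + Polynomial.C c ^ 2) ^ (2 ^ (N - 1) - 1) : Polynomial L).Monic := by
    have hm : (Polynomial.X ^ 2 + Polynomial.C c ^ 2 : Polynomial L).Monic := by
      rw [← Polynomial.C_pow]; exact Polynomial.monic_X_pow_add_C _ two_ne_zero
    have hd : (Polynomial.X ^ 2 + Polynomial.C c ^ 2 : Polynomial L).natDegree = 2 := by
      rw [← Polynomial.C_pow]; exact Polynomial.natDegree_X_pow_add_C
    refine ⟨?_, hm.pow _⟩
    rw [hm.natDegree_pow, hd]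
    omega
  have hpe : ∀ j, ((Polynomial.X ^ 2 + Polynomial.C c ^ 2) ^ (2 ^ (N - 1) - 1) *
        (Polynomial.X * Polynomial.C c) : Polynomial L).coeff (j + 1) =
        ((Polynomial.X ^ 2 + Polynomial.C c ^ 2) ^ (2 ^ (N - 1) - 1) : Polynomial L).coeff j * c := by
    intro j
    rw [← mul_assoc, Polynomial.coeff_mul_C, Polynomial.coeff_mul_X]
  refine ⟨hp, ?_, ?_, fun T h1 h2 => ?_⟩
  · rw [hc]
    simp only [Finset.mem_univ, Finset.filter_true, topExp_apply, if_true]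
    rw [hu, hpu, Polynomial.coeff_add, Polynomial.coeff_X_pow, if_pos rfl, Polynomial.coeff_C,
      if_neg (by omega), add_zero]
  · rw [hc]
    simp only [Finset.notMem_empty, Finset.filter_false, topExp_apply, if_false]
    rw [he, show 2 ^ N - 1 = (2 ^ N - 2) + 1 by omega, hpe]
    have := hmon.2.coeff_natDegree
    rw [hmon.1] at this
    rw [this, one_mul]
  · rw [hc]
    by_cases h3 : (Finset.univ.filter fun i : Fin M => i.castSucc ∈ T) = Finset.univ
    · have hl : Fin.last M ∉ T := by
        intro hl
        apply h1
        ext i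
        refine Fin.lastCases (by simpa using hl) (fun i => ?_) i
        have : i ∈ (Finset.univ.filter fun i : Fin M => i.castSucc ∈ T) := by
          rw [h3]; exact Finset.mem_univ i
        simpa using this
      rw [h3, hu, hpu, topExp_apply, if_neg hl, Polynomial.coeff_add, Polynomial.coeff_X_pow,
        Polynomial.coeff_C, if_neg (by omega), if_neg, add_zero]
      have : 2 ≤ 2 ^ N := by omega
      omega
    by_cases h4 : (Finset.univ.filter fun i : Fin M => i.castSucc ∈ T) = ∅
    · have hl : Fin.last M ∈ T := by
        by_contra hl
        apply h2
        ext i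
        refine Fin.lastCases (by simpa using hl) (fun i => ?_) i
        have : i ∉ (Finset.univ.filter fun i : Fin M => i.castSucc ∈ T) := by simp [h4]
        simpa using this
      rw [h4, he, topExp_apply, if_pos hl, show 2 ^ N = (2 ^ N - 1) + 1 by omega, hpe,
        Polynomial.coeff_eq_zero_of_natDegree_lt, zero_mul]
      rw [hmon.1]
      omega
    · rw [hn _ h3 h4, Polynomial.coeff_zero]

/-- With the last free variable specialised to `t`, `S_3(t, c, X) = a (X - r) (X - s)` with `a = t²
+ c²` and `a (r + s) = t c`. The resultant is thus a power of `a` times two previous summation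
polynomials with last arguments `r` and `s`, whose shapes multiply. The field `L` is quantified
inside the induction because `r` and `s` live in a larger field. -/
theorem hasTopShape_semaevAt {K : Type*} [Field K] [CharP K 2] (a₆ : K) (k : ℕ) :
    ∀ (L : Type u) [Field L] [Algebra K L] (c : L),
      HasTopShape (2 ^ (k + 1)) (semaevAt a₆ (k + 2) c) c := by
  induction k with
  | zero => intro L _ _ c; exact hasTopShape_semaevAt_two a₆ c
  | succ k ih =>
    intro L _ _ c
    have : CharP L 2 := charP_of_injective_algebraMap (algebraMap K L).injective 2
    -- An algebraic closure of `L(t)`: it contains the roots `r` and `s`, and `L[t]` embeds in it,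
    -- so identities of coefficients can be pulled back.
    let Ω := AlgebraicClosure (FractionRing (Polynomial L))
    have hinj : Function.Injective (algebraMap (Polynomial L) Ω) := by
      rw [IsScalarTower.algebraMap_eq (Polynomial L) (FractionRing (Polynomial L)) Ω]
      exact (algebraMap (FractionRing (Polynomial L)) Ω).injective.comp
        (IsFractionRing.injective _ _)
    let ι : Polynomial L →ₐ[K] Ω := IsScalarTower.toAlgHom K (Polynomial L) Ω
    have hι : Function.Injective ι := hinj
    have : CharP Ω 2 := charP_of_injective_algebraMap (algebraMap K Ω).injective 2
    have hA : (Polynomial.X ^ 2 + Polynomial.C c ^ 2 : Polynomial L) ≠ 0 := by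
      rw [← Polynomial.C_pow]; exact (Polynomial.monic_X_pow_add_C _ two_ne_zero).ne_zero
    have hA' : ι Polynomial.X ^ 2 + ι (Polynomial.C c) ^ 2 ≠ 0 := by
      rw [← map_pow, ← map_pow, ← map_add]
      exact fun h => hA (hι (h.trans (map_zero ι).symm))
    let φ : MvPolynomial (Fin (k + 3)) L →ₐ[K] MvPolynomial (Fin (k + 2)) Ω :=
      (mapAlgHom ι).comp ((splitLast L (k + 2)).restrictScalars K)
    have hφ : ∀ p e, coeff e (φ p) = ι (coeff e (splitLast L (k + 2) p)) := by
      intro p e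
      exact coeff_map _ _ _
    let v : Fin (k + 4) → MvPolynomial (Fin (k + 2)) Ω := fun i =>
      φ ((Fin.snoc (α := fun _ => MvPolynomial (Fin (k + 3)) L) X (C c) :
        Fin (k + 4) → MvPolynomial (Fin (k + 3)) L) i)
    have hv : ∀ i, v (Fin.castAdd 2 i) = X i := by
      intro i
      simp only [v]
      rw [show Fin.castAdd 2 i = i.castSucc.castSucc from rfl, Fin.snoc_castSucc]
      simp [φ, splitLast]
    have hv0 : v (Fin.natAdd (k + 2) (0 : Fin 2)) = C (ι Polynomial.X) := by
      simp only [v]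
      rw [show Fin.natAdd (k + 2) (0 : Fin 2) = (Fin.last (k + 2)).castSucc from rfl,
        Fin.snoc_castSucc]
      simp [φ, splitLast]
    have hv1 : v (Fin.natAdd (k + 2) (1 : Fin 2)) = C (ι (Polynomial.C c)) := by
      simp only [v]
      rw [show Fin.natAdd (k + 2) (1 : Fin 2) = Fin.last (k + 3) from rfl, Fin.snoc_last]
      simp [φ, splitLast]
    obtain ⟨r, s, hrs, h⟩ := aeval_semaev_eq_mul a₆ k _ _ hA' v hv hv0 hv1
    have hs := h
    rw [← comp_aeval, AlgHom.comp_apply, ← semaevAt] at hs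
    have hmul := (ih Ω r).mul (by positivity) (ih Ω s)
    have hc : ∀ e, ι (coeff e (splitLast L (k + 2) (semaevAt a₆ (k + 3) c))) =
        ι (Polynomial.X ^ 2 + Polynomial.C c ^ 2) ^ 2 ^ (k + 1) *
          coeff e (semaevAt a₆ (k + 2) r * semaevAt a₆ (k + 2) s) := by
      intro e
      rw [← hφ, hs, coeff_C_mul, map_add, map_pow, map_pow]
    rw [← pow_succ'] at hmul
    refine HasTopShape.of_splitLast (M := k + 2) (by omega)
      (degreeOf_semaevAt_le a₆ (k + 1) c) ?_ ?_ fun T h1 h2 => ?_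
    · apply hι
      rw [hc, hmul.coeff_univ, mul_one, map_pow]
      rfl
    · apply hι
      -- Replacing `t c` by `a (r + s)` absorbs the missing factor `a` without division.
      rw [hc, hmul.coeff_empty, map_mul, map_mul, map_pow, ← hrs]
      rw [map_add, map_pow, map_pow, ← mul_assoc, ← pow_succ, Nat.add_sub_cancel,
        Nat.sub_add_cancel Nat.one_le_two_pow]
    · apply hι
      rw [hc, hmul.coeff_ne T h1 h2, mul_zero, map_zero]

/-! ### Leading forms: from the Boolean ring to the graded ring -/

theorem toGr_eq_zero_iff {σ K : Type*} [Field K] (p : MvPolynomial σ K) :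
    toGr σ K p = 0 ↔ ∀ e ∈ p.support, ∃ i, 2 ≤ e i := by
  have h : (Set.range fun i : σ => (X i ^ 2 : MvPolynomial σ K)) =
      (fun s => monomial s (1 : K)) '' (Set.range fun i : σ => Finsupp.single i 2) := by
    ext x
    simp [X_pow_eq_monomial]
  rw [Ideal.Quotient.mkₐ_eq_mk, Ideal.Quotient.eq_zero_iff_mem, h, mem_ideal_span_monomial_image]
  simp

theorem smul_eq_toGr_mul {σ K : Type*} [Field K] (c : K) (x : GrRing σ K) :
    c • x = toGr σ K (C c) * x := by
  obtain ⟨x, rfl⟩ := Ideal.Quotient.mkₐ_surjective K _ x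
  exact Algebra.smul_def (A := GrRing σ K) c _

/-- The number of occurrences, with coefficients, of monomials with given support. -/
def supportFunctional (σ K : Type*) [DecidableEq σ] [Field K] (s : Finset σ) :
    MvPolynomial σ K →ₗ[K] K :=
  (basisMonomials σ K).constr K fun e => if e.support = s then 1 else 0

theorem supportFunctional_monomial {σ K : Type*} [DecidableEq σ] [Field K] (s : Finset σ)
    (e : σ →₀ ℕ) (a : K) :
    supportFunctional σ K s (monomial e a) = if e.support = s then a else 0 := by
  have h : monomial e a = a • basisMonomials σ K e := by
    rw [coe_basisMonomials, smul_monomial, smul_eq_mul, mul_one]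
  rw [h, map_smul, supportFunctional, Module.Basis.constr_basis]
  split_ifs <;> simp

/-- Multiplying a monomial by `X i ^ 2` or by `X i` yields the same support. -/
theorem supportFunctional_mul_sub {σ K : Type*} [DecidableEq σ] [Field K] (s : Finset σ) (i : σ)
    (q : MvPolynomial σ K) : supportFunctional σ K s (q * (X i ^ 2 - X i)) = 0 := by
  induction q using MvPolynomial.induction_on' with
  | add p q hp hq => rw [add_mul, map_add, hp, hq, add_zero]
  | monomial e a =>
    have h : (e + Finsupp.single i 2).support = (e + Finsupp.single i 1).support := by
      ext j
      by_cases hj : i = j <;> simp [hj]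
    rw [mul_sub, X_pow_eq_monomial, X, monomial_mul, monomial_mul, mul_one, map_sub,
      supportFunctional_monomial, supportFunctional_monomial, h, sub_self]

theorem supportFunctional_eq_zero {σ K : Type*} [DecidableEq σ] [Field K] (s : Finset σ)
    {p : MvPolynomial σ K} (hp : toBool σ K p = 0) : supportFunctional σ K s p = 0 := by
  rw [Ideal.Quotient.mkₐ_eq_mk, Ideal.Quotient.eq_zero_iff_mem] at hp
  have h : ∀ q, supportFunctional σ K s (q * p) = 0 := by
    refine Submodule.span_induction (p := fun x _ => ∀ q, supportFunctional σ K s (q * x) = 0)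
      ?_ (fun q => by rw [mul_zero, map_zero])
      (fun x y _ _ hx hy q => by rw [mul_add, map_add, hx, hy, add_zero])
      (fun r x _ hx q => by rw [smul_eq_mul, ← mul_assoc, hx]) hp
    rintro _ ⟨i, rfl⟩ q
    exact supportFunctional_mul_sub s i q
  simpa using h 1

/-- The leading form of a relation of the Boolean ring is a relation of the associated graded
ring. -/
theorem toGr_homogeneousComponent_eq_zero {σ K : Type*} [Field K] {p : MvPolynomial σ K} {d : ℕ}
    (hp : toBool σ K p = 0) (hd : p.totalDegree ≤ d) :
    toGr σ K (homogeneousComponent d p) = 0 := by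
  classical
  rw [toGr_eq_zero_iff]
  intro e he
  by_contra! hlt
  rw [mem_support_iff, coeff_homogeneousComponent] at he
  obtain ⟨hed, he0⟩ := ite_ne_right_iff.mp he
  have hcard' : e.support.card = d := by
    rw [← hed, Finsupp.degree_apply, Finset.card_eq_sum_ones]
    refine Finset.sum_congr rfl fun i hi => ?_
    have := hlt i
    have := Finsupp.mem_support_iff.mp hi
    omega
  apply he0
  -- Here `e` is squarefree of degree `d`. Any other exponent with the same support has larger
  -- degree, so the functional returns exactly the coefficient at `e`.
  have h := supportFunctional_eq_zero e.support hp
  rw [p.as_sum, map_sum, Finset.sum_congr rfl fun v _ => supportFunctional_monomial _ _ _,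
    Finset.sum_eq_single e, if_pos rfl] at h
  · exact h
  · intro v hv hne
    refine if_neg fun hs => hne ?_
    have hvd : v.degree ≤ d := (le_totalDegree hv).trans hd
    have hle : ∀ i ∈ v.support, 1 ≤ v i := fun i hi =>
      Nat.one_le_iff_ne_zero.mpr (Finsupp.mem_support_iff.mp hi)
    have hsum : ∑ i ∈ v.support, 1 = ∑ i ∈ v.support, v i := by
      refine le_antisymm (Finset.sum_le_sum hle) ?_
      rw [← Finset.card_eq_sum_ones, ← Finsupp.degree_apply, hs, hcard']
      exact hvd
    have h1 := (Finset.sum_eq_sum_iff_of_le hle).mp hsum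
    ext i
    by_cases hi : i ∈ v.support
    · have h2 := h1 i hi
      have h3 := hlt i
      have h4 := Finsupp.mem_support_iff.mp (hs ▸ hi)
      omega
    · have h4 := hi
      rw [hs] at h4
      rw [Finsupp.notMem_support_iff.mp hi, Finsupp.notMem_support_iff.mp h4]
  · intro hn
    rw [if_pos rfl]
    exact notMem_support_iff.mp hn

/-! ### Linear relations and the first fall degree -/

/-- The image in the graded ring of the polynomials without terms of degree less than `2`. -/
def grIdealTwo (σ K : Type*) [Field K] : Ideal (GrRing σ K) :=
  (idealOfVars σ K ^ 2).map (toGr σ K)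

/-- The relations `X i ^ 2` of the graded ring have degree two and cannot affect linear forms. -/
theorem homogeneous_one_eq_zero_of_mem {σ K : Type*} [Field K] {p : MvPolynomial σ K}
    (hp : p.IsHomogeneous 1) (h : toGr σ K p ∈ grIdealTwo σ K) : p = 0 := by
  obtain ⟨q, hq, hqp⟩ := (Ideal.mem_map_iff_of_surjective (toGr σ K)
    (Ideal.Quotient.mkₐ_surjective K _)).mp h
  have h0 : toGr σ K (p - q) = 0 := by rw [map_sub, hqp, sub_self]
  rw [toGr_eq_zero_iff] at h0
  rw [mem_pow_idealOfVars_iff'] at hq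
  ext e
  rw [coeff_zero]
  by_contra he
  have hdeg : e.degree = 1 := by
    by_contra hne
    exact he (hp.coeff_eq_zero hne)
  obtain ⟨i, hi⟩ := h0 e (by rw [mem_support_iff, coeff_sub, hq e (by omega), sub_zero]; exact he)
  have := Finsupp.le_degree i e
  omega

/-- Used with the ideal of elements of degree at least two: a relation with nonzero linear
coefficients is then not trivial. -/
theorem trivialRelations_le {σ K : Type*} [Field K] {r : ℕ} {h : Fin r → GrRing σ K}
    (J : Ideal (GrRing σ K)) (hJ : ∀ i, h i ∈ J) {g : Fin r → GrRing σ K}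
    (hg : g ∈ trivialRelations h) (i : Fin r) : g i ∈ J := by
  have hs : ∀ (k : Fin r) (x : GrRing σ K), x ∈ J →
      (Pi.single k x : Fin r → GrRing σ K) i ∈ J := by
    intro k x hx
    by_cases hk : i = k
    · subst hk; simpa using hx
    · rw [Pi.single_eq_of_ne hk]; exact J.zero_mem
  have hle : trivialRelations h ≤ Submodule.comap (LinearMap.proj i) J := by
    refine Submodule.span_le.mpr (Set.union_subset ?_ ?_)
    · rintro _ ⟨⟨a, b⟩, rfl⟩
      exact J.add_mem (hs _ _ (hJ _)) (hs _ _ (hJ _))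
    · rintro _ ⟨k, rfl⟩
      exact hs _ _ (hJ _)
  exact hle hg

theorem mem_leadingPart {σ K : Type*} [Field K] {d : ℕ} {V : Submodule K (BoolRing σ K)}
    {p : MvPolynomial σ K} (hd : p.totalDegree ≤ d) (hp : toBool σ K p ∈ V) :
    toGr σ K (homogeneousComponent d p) ∈ leadingPart d V :=
  ⟨p, ⟨hp, (mem_restrictTotalDegree _ _ _).mpr hd⟩, rfl⟩

theorem mem_grIdealTwo_of_mem_leadingPart {σ K : Type*} [Field K] {d : ℕ} (hd : 2 ≤ d)
    {V : Submodule K (BoolRing σ K)} {x : GrRing σ K} (hx : x ∈ leadingPart d V) :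
    x ∈ grIdealTwo σ K := by
  obtain ⟨p, -, rfl⟩ := hx
  refine Ideal.mem_map_of_mem _ ((mem_pow_idealOfVars_iff' _ _).mpr fun e he => ?_)
  rw [coeff_homogeneousComponent, if_neg (by omega)]

/-- A criterion for the degree of a subspace. -/
theorem filtrationDegree_eq {σ K : Type*} [Field K] {V : Submodule K (BoolRing σ K)} {d : ℕ}
    (hV : V ≤ boolFiltration σ K d) {p : MvPolynomial σ K} (hd : p.totalDegree ≤ d)
    (hp : toBool σ K p ∈ V) (h0 : toGr σ K (homogeneousComponent d p) ≠ 0) :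
    filtrationDegree V = d := by
  refine le_antisymm (Nat.sInf_le hV) ?_
  by_contra! hlt
  obtain ⟨q, hq, hqp⟩ := Nat.sInf_mem (s := {d | V ≤ boolFiltration σ K d}) ⟨d, hV⟩ hp
  have hq : q.totalDegree ≤ filtrationDegree V := (mem_restrictTotalDegree _ _ _).mp hq
  -- If `q` represents the same class in degree less than `d`, then `p - q` has the same degree `d`
  -- part as `p`.
  have h := toGr_homogeneousComponent_eq_zero (p := p - q) (d := d)
    (by rw [map_sub, sub_eq_zero]; exact hqp.symm)
    ((totalDegree_sub _ _).trans (max_le hd (hq.trans hlt.le)))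
  rw [map_sub, homogeneousComponent_eq_zero _ _ (hq.trans_lt hlt), sub_zero] at h
  exact h0 h

/-- A relation with linear coefficients between leading forms of elements of `V` bounds the first
fall degree, if the corresponding tensor does not vanish. -/
theorem firstFallDegree_le_succ {σ K ι : Type*} [Finite σ] [Field K] [Fintype ι]
    {V : Submodule K (BoolRing σ K)} {d : ℕ} (hd : 2 ≤ d) (hV : V ≤ boolFiltration σ K d)
    (p l : ι → MvPolynomial σ K) (hpd : ∀ i, (p i).totalDegree ≤ d)
    (hpV : ∀ i, toBool σ K (p i) ∈ V) (hl : ∀ i, (l i).IsHomogeneous 1)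
    (h0 : toGr σ K (∑ i, l i * homogeneousComponent d (p i)) = 0)
    (φ : GrRing σ K →ₗ[K] K)
    (hφ : ∑ i, C (φ (toGr σ K (homogeneousComponent d (p i)))) * l i ≠ 0) :
    firstFallDegree V ≤ ((d + 1 : ℕ) : ℕ∞) := by
  have hdeg : filtrationDegree V = d := by
    obtain ⟨i, -, hi⟩ := Finset.exists_ne_zero_of_sum_ne_zero hφ
    refine filtrationDegree_eq hV (hpd i) (hpV i) fun h => hi ?_
    rw [h, map_zero, C_0, zero_mul]
  subst hdeg
  set d := filtrationDegree V
  rw [firstFallDegree]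
  split_ifs with hdim
  · exact_mod_cast Nat.le_succ d
  set B := Module.finBasis K (leadingPart d V)
  let w : ι → leadingPart d V := fun i => ⟨_, mem_leadingPart (hpd i) (hpV i)⟩
  have hw : ∀ i, toGr σ K (homogeneousComponent d (p i)) =
      ∑ j, B.repr (w i) j • (B j : GrRing σ K) := by
    intro i
    have := congrArg Subtype.val (B.sum_repr (w i))
    rw [← show (w i : GrRing σ K) = toGr σ K (homogeneousComponent d (p i)) from rfl, ← this,
      Submodule.coe_sum]
    rfl
  -- The coefficients of the given relation after its leading forms are expanded in the chosen basis
  -- of the leading part.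
  let q : Fin (Module.finrank K (leadingPart d V)) → MvPolynomial σ K :=
    fun j => ∑ i, C (B.repr (w i) j) * l i
  have hq : ∀ j, (q j).IsHomogeneous 1 := fun j =>
    IsHomogeneous.sum _ _ _ fun i _ => by simpa using (isHomogeneous_C σ _).mul (hl i)
  refine sInf_le ⟨1, rfl, fun j => toGr σ K (q j), fun j => ⟨q j, hq j, rfl⟩, ?_, fun hU => hφ ?_⟩
  · rw [← h0, map_sum]
    simp only [map_mul, hw, q, map_sum, Finset.sum_mul, Finset.mul_sum]
    rw [Finset.sum_comm]
    refine Finset.sum_congr rfl fun i _ => Finset.sum_congr rfl fun j _ => ?_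
    rw [smul_eq_toGr_mul]
    ring
  · have hq0 : ∀ j, q j = 0 := fun j => homogeneous_one_eq_zero_of_mem (hq j)
      (trivialRelations_le (grIdealTwo σ K)
        (fun i => mem_grIdealTwo_of_mem_leadingPart hd (B i).2) hU j)
    -- Contracting the tensor of the relation with `φ` gives the same linear form before and after
    -- the change to the basis `B`.
    have : ∑ i, C (φ (toGr σ K (homogeneousComponent d (p i)))) * l i =
        ∑ j, C (φ (B j)) * q j := by
      simp only [hw, q, map_sum, map_smul, Finset.sum_mul, Finset.mul_sum, smul_eq_mul, C_mul]
      rw [Finset.sum_comm]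
      refine Finset.sum_congr rfl fun i _ => Finset.sum_congr rfl fun j _ => ?_
      ring
    rw [this]
    exact Finset.sum_eq_zero fun j _ => by rw [hq0, mul_zero]

/-! ### Frobenius linear forms and the leading form of the descent -/

/-- The linear form `∑_l ν_l ^ (2 ^ j) y_{il}`, which represents `x_i ^ (2 ^ j)`. -/
def frobeniusForm {K : Type*} [Field K] {m n' : ℕ} (ν : Fin n' → K) (i : Fin m) (j : ℕ) :
    MvPolynomial (Fin m × Fin n') K :=
  ∑ l, X (i, l) * C (ν l ^ 2 ^ j)

theorem isHomogeneous_frobeniusForm {K : Type*} [Field K] {m n' : ℕ} (ν : Fin n' → K) (i : Fin m)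
    (j : ℕ) : (frobeniusForm ν i j).IsHomogeneous 1 :=
  IsHomogeneous.sum _ _ _ fun l _ => (isHomogeneous_X K (i, l)).mul (isHomogeneous_C _ (ν l ^ 2 ^ j))

/-- Frobenius is additive, and variables are idempotent in the Boolean ring. -/
theorem toBool_frobeniusForm_pow {K : Type*} [Field K] [CharP K 2] {m n' : ℕ} (ν : Fin n' → K)
    (i : Fin m) (j : ℕ) : toBool _ K (frobeniusForm ν i 0 ^ 2 ^ j) =
      toBool _ K (frobeniusForm ν i j) := by
  have hX : ∀ s : Fin m × Fin n', toBool (Fin m × Fin n') K (X s ^ 2 ^ j) = toBool _ K (X s) := by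
    intro s
    have h2 : toBool (Fin m × Fin n') K (X s) ^ 2 = toBool _ K (X s) := by
      rw [← map_pow, ← sub_eq_zero, ← map_sub]
      exact Ideal.Quotient.eq_zero_iff_mem.mpr (Ideal.subset_span ⟨s, rfl⟩)
    induction j with
    | zero => rw [pow_zero, pow_one]
    | succ j ih => rw [pow_succ, pow_mul, map_pow, ih, h2]
  rw [frobeniusForm, frobeniusForm, sum_pow_char_pow 2, map_sum, map_sum]
  refine Finset.sum_congr rfl fun l _ => ?_
  rw [mul_pow, map_mul, hX, map_mul, pow_zero, pow_one, ← C_pow]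

theorem toGr_frobeniusForm_sq {K : Type*} [Field K] [CharP K 2] {m n' : ℕ} (ν : Fin n' → K)
    (i : Fin m) (j : ℕ) : toGr _ K (frobeniusForm ν i j ^ 2) = 0 := by
  rw [frobeniusForm, CharTwo.sum_sq, map_sum]
  refine Finset.sum_eq_zero fun l _ => ?_
  have h2 : toGr (Fin m × Fin n') K (X (i, l) ^ 2) = 0 :=
    Ideal.Quotient.eq_zero_iff_mem.mpr (Ideal.subset_span ⟨(i, l), rfl⟩)
  rw [mul_pow, map_mul, h2, zero_mul]

/-- The positions of the binary digits `1` of a natural number. -/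
abbrev binaryDigits (a : ℕ) : Finset ℕ := a.bitIndices.toFinset

theorem prod_pow_binaryDigits {R : Type*} [CommMonoid R] (x : R) (a : ℕ) :
    ∏ j ∈ binaryDigits a, x ^ 2 ^ j = x ^ a := by
  rw [Finset.prod_pow_eq_pow_sum, Finset.sum_toFinset_bitIndices_two_pow]

theorem binaryDigits_two_pow_sub_one (k : ℕ) : binaryDigits (2 ^ k - 1) = Finset.range k := by
  rw [← Finset.toFinset_bitIndices_sum_two_pow (Finset.range k), Nat.geomSum_eq le_rfl]
  simp

theorem binaryDigits_subset {a k : ℕ} (ha : a < 2 ^ k) : binaryDigits a ⊆ Finset.range k := by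
  intro j hj
  rw [List.mem_toFinset] at hj
  exact Finset.mem_range.mpr
    ((Nat.pow_lt_pow_iff_right one_lt_two).mp ((Nat.two_pow_le_of_mem_bitIndices hj).trans_lt ha))

theorem card_binaryDigits_le {a k : ℕ} (hk : 2 ≤ k) (ha : a ≤ 2 ^ k) :
    (binaryDigits a).card ≤ k := by
  rcases ha.lt_or_eq with h | rfl
  · simpa using Finset.card_le_card (binaryDigits_subset h)
  · simp [binaryDigits]; omega

/-- The bound `2 ≤ k` excludes `a = 2 ^ k`, which has a single digit `1`; for `k = 1` both `1` and
`2` would qualify. -/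
theorem eq_of_card_binaryDigits {a k : ℕ} (hk : 2 ≤ k) (ha : a ≤ 2 ^ k)
    (h : (binaryDigits a).card = k) : a = 2 ^ k - 1 := by
  rcases ha.lt_or_eq with h' | rfl
  · have := Finset.eq_of_subset_of_card_le (binaryDigits_subset h') (by simp [h])
    rw [← binaryDigits_two_pow_sub_one] at this
    rw [← Finset.sum_toFinset_bitIndices_two_pow a,
      ← Finset.sum_toFinset_bitIndices_two_pow (2 ^ k - 1)]
    exact congrArg (fun s => ∑ i ∈ s, 2 ^ i) this
  · simp [binaryDigits] at h; omega

/-- The polynomial obtained from `p(x_1, …, x_m)` by substituting linear forms for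
`x_i ^ (2 ^ j)`. -/
def linearizedSubst {K : Type*} [Field K] {m n' : ℕ} (ν : Fin n' → K) (p : MvPolynomial (Fin m) K) :
    MvPolynomial (Fin m × Fin n') K :=
  ∑ a ∈ p.support, C (coeff a p) * ∏ i, ∏ j ∈ binaryDigits (a i), frobeniusForm ν i j

theorem toBool_linearizedSubst {K : Type*} [Field K] [CharP K 2] {m n' : ℕ} (ν : Fin n' → K)
    (p : MvPolynomial (Fin m) K) : toBool _ K (linearizedSubst ν p) =
      toBool _ K (aeval (fun i => frobeniusForm ν i 0) p) := by
  rw [linearizedSubst, aeval_def, eval₂_eq', map_sum, map_sum]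
  refine Finset.sum_congr rfl fun a _ => ?_
  rw [map_mul, map_mul, map_prod, map_prod, MvPolynomial.algebraMap_eq]
  congr 1
  refine Finset.prod_congr rfl fun i _ => ?_
  rw [← prod_pow_binaryDigits, map_prod, map_prod]
  exact Finset.prod_congr rfl fun j _ => (toBool_frobeniusForm_pow ν i j).symm

theorem isHomogeneous_term {K : Type*} [Field K] {m n' : ℕ} (ν : Fin n' → K) (u : K)
    (a : Fin m →₀ ℕ) : (C u * ∏ i, ∏ j ∈ binaryDigits (a i), frobeniusForm ν i j).IsHomogeneous
      (∑ i, (binaryDigits (a i)).card) := by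
  have h : (∏ i, ∏ j ∈ binaryDigits (a i), frobeniusForm ν i j).IsHomogeneous
      (∑ i, (binaryDigits (a i)).card) := by
    refine IsHomogeneous.prod _ _ _ fun i _ => ?_
    rw [Finset.card_eq_sum_ones]
    exact IsHomogeneous.prod _ _ _ fun j _ => isHomogeneous_frobeniusForm ν i j
  simpa using (isHomogeneous_C _ u).mul h

theorem totalDegree_linearizedSubst_le {K : Type*} [Field K] {m n' k : ℕ} (hk : 2 ≤ k)
    (ν : Fin n' → K) {p : MvPolynomial (Fin m) K} (hp : ∀ i, degreeOf i p ≤ 2 ^ k) :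
    (linearizedSubst ν p).totalDegree ≤ m * k := by
  refine (totalDegree_finsetSum _ _).trans (Finset.sup_le fun a ha => ?_)
  refine (isHomogeneous_term ν _ a).totalDegree_le.trans ?_
  refine (Finset.sum_le_card_nsmul _ _ k fun i _ => ?_).trans (by simp)
  exact card_binaryDigits_le hk ((le_degreeOf_of_mem_support i ha).trans (hp i))

/-- A term reaches degree `m * k` only if every exponent has `k` binary digits `1`, that is, equals
`2 ^ k - 1`. This is the monomial `topExp (2 ^ k) ∅`, with coefficient `c`. -/
theorem homogeneousComponent_linearizedSubst {K : Type*} [Field K] {m n' k : ℕ} (hk : 2 ≤ k)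
    (ν : Fin n' → K) {p : MvPolynomial (Fin m) K} {c : K} (hp : HasTopShape (2 ^ k) p c) :
    homogeneousComponent (m * k) (linearizedSubst ν p) =
      C c * ∏ i, ∏ j ∈ Finset.range k, frobeniusForm ν i j := by
  rw [linearizedSubst, map_sum, Finset.sum_congr rfl fun a _ =>
    homogeneousComponent_of_mem (isHomogeneous_term ν (coeff a p) a),
    Finset.sum_eq_single (topExp (2 ^ k) ∅)]
  · simp only [topExp_apply, Finset.notMem_empty, if_false, binaryDigits_two_pow_sub_one,
      hp.coeff_empty]
    rw [if_pos (by simp)]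
  · intro a ha hne
    refine if_neg fun h => hne ?_
    have hle : ∀ i ∈ Finset.univ, (binaryDigits (a i)).card ≤ k := fun i _ =>
      card_binaryDigits_le hk ((le_degreeOf_of_mem_support i ha).trans (hp.degreeOf_le i))
    have heq := (Finset.sum_eq_sum_iff_of_le hle).mp (by rw [← h]; simp)
    ext i
    rw [eq_of_card_binaryDigits hk ((le_degreeOf_of_mem_support i ha).trans (hp.degreeOf_le i))
      (heq i (Finset.mem_univ i))]
    simp [topExp_apply]
  · intro h
    rw [notMem_support_iff.mp h, C_0, zero_mul, ite_self]

/-! ### Nonvanishing of the leading form and its annihilators -/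

/-- The rows `(ν_1 ^ (2 ^ j), …, ν_{n'} ^ (2 ^ j))`, `j < k`, of a Moore matrix are linearly
independent. -/
theorem linearIndependent_moore {K : Type*} [Field K] [Algebra (ZMod 2) K] {n' k : ℕ}
    (hk : k ≤ n') {ν : Fin n' → K} (hν : LinearIndependent (ZMod 2) ν) :
    LinearIndependent K (fun (j : Fin k) (l : Fin n') => ν l ^ 2 ^ (j : ℕ)) := by
  have : CharP K 2 := charP_of_injective_algebraMap (algebraMap (ZMod 2) K).injective 2
  rw [Fintype.linearIndependent_iff]
  intro a ha
  have hl : ∀ l, ∑ j, a j * ν l ^ 2 ^ (j : ℕ) = 0 := by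
    intro l
    simpa using congrFun ha l
  -- This additive polynomial vanishes at every `ν l`, hence on their `F_2`-span, which has `2 ^ n'`
  -- elements; its degree is smaller.
  let P : Polynomial K := ∑ j : Fin k, Polynomial.C (a j) * Polynomial.X ^ 2 ^ (j : ℕ)
  have hP : P = 0 := by
    refine Polynomial.eq_zero_of_natDegree_lt_card_of_eval_eq_zero P
      (f := fun ε : Fin n' → ZMod 2 => ∑ l, ε l • ν l) ?_ ?_ ?_
    · exact hν.fintypeLinearCombination_injective
    · intro ε
      have hz : ∀ (x : ZMod 2) (j : ℕ), x ^ 2 ^ j = x := by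
        intro x j
        exact ZMod.pow_card_pow x
      simp only [P, Polynomial.eval_finsetSum, Polynomial.eval_mul, Polynomial.eval_C,
        Polynomial.eval_pow, Polynomial.eval_X, sum_pow_char_pow 2, smul_pow, hz, Finset.mul_sum]
      rw [Finset.sum_comm]
      refine Finset.sum_eq_zero fun l _ => ?_
      simp only [mul_smul_comm]
      rw [← Finset.smul_sum, hl, smul_zero]
    · have hcard : Fintype.card (Fin n' → ZMod 2) = 2 ^ n' := by simp [ZMod.card]
      rw [hcard]
      refine lt_of_le_of_lt (b := 2 ^ n' - 1) ?_ (by have := Nat.two_pow_pos n'; omega)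
      refine Polynomial.natDegree_sum_le_of_forall_le _ _ fun j _ => ?_
      refine (Polynomial.natDegree_C_mul_X_pow_le _ _).trans ?_
      have : 2 ^ (j : ℕ) < 2 ^ n' := Nat.pow_lt_pow_right one_lt_two (j.2.trans_le hk)
      omega
  intro j
  have hc : P.coeff (2 ^ (j : ℕ)) = a j := by
    simp only [P, Polynomial.finsetSum_coeff, Polynomial.coeff_C_mul_X_pow]
    rw [Finset.sum_eq_single j]
    · simp
    · intro i _ hij
      refine if_neg fun h => hij ?_
      exact Fin.ext (Nat.pow_right_injective le_rfl h).symm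
    · simp
  rw [← hc, hP, Polynomial.coeff_zero]

/-- Substituting linear forms for the variables preserves the relations of the graded ring. -/
theorem toGr_aeval_eq_zero {σ τ K : Type*} [Field K] [CharP K 2] [Fintype τ] (M : σ → τ → K)
    {p : MvPolynomial σ K} (hp : toGr σ K p = 0) :
    toGr τ K (aeval (fun s => ∑ t, C (M s t) * X t) p) = 0 := by
  let f : MvPolynomial σ K →ₐ[K] GrRing τ K :=
    (toGr τ K).comp (aeval (fun s => ∑ t, C (M s t) * X t))
  have hle : Ideal.span (Set.range fun i : σ => (X i ^ 2 : MvPolynomial σ K)) ≤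
      RingHom.ker f := by
    rw [Ideal.span_le]
    rintro _ ⟨s, rfl⟩
    have hx : ∀ t, toGr τ K (X t ^ 2) = 0 := fun t =>
      Ideal.Quotient.eq_zero_iff_mem.mpr (Ideal.subset_span ⟨t, rfl⟩)
    rw [SetLike.mem_coe, RingHom.mem_ker]
    simp only [f, AlgHom.comp_apply, map_pow, aeval_X]
    rw [← map_pow, CharTwo.sum_sq, map_sum]
    refine Finset.sum_eq_zero fun t _ => ?_
    rw [mul_pow, map_mul, hx, mul_zero]
  exact hle (Ideal.Quotient.eq_zero_iff_mem.mp hp)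

/-- `M` comes from a left inverse of the injective map `a ↦ ∑ a j • v j`. -/
theorem exists_dual_of_linearIndependent {K ι κ : Type*} [Field K] [Fintype ι] [Fintype κ]
    [DecidableEq κ] {v : κ → ι → K} (hv : LinearIndependent K v) :
    ∃ M : ι → κ → K, ∀ j j', ∑ l, v j l * M l j' = if j = j' then 1 else 0 := by
  classical
  obtain ⟨g, hg⟩ := (Fintype.linearCombination K v).exists_leftInverse_of_injective
    (LinearMap.ker_eq_bot.mpr (hv.fintypeLinearCombination_injective))
  refine ⟨fun l j' => g (Pi.single l 1) j', fun j j' => ?_⟩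
  have h1 : g (v j) = Pi.single j 1 := by
    have := LinearMap.congr_fun hg (Pi.single j 1)
    simpa [Fintype.linearCombination_apply_single] using this
  have h2 : v j = ∑ l, v j l • (Pi.single l 1 : ι → K) := by
    ext l; simp [Finset.sum_apply, Pi.single_apply]
  have h3 := congrFun h1 j'
  rw [h2, map_sum, Finset.sum_apply] at h3
  simp only [map_smul, Pi.smul_apply, smul_eq_mul] at h3
  rw [h3, Pi.single_apply]
  simp [eq_comm]

/-- The product of linearly independent linear forms does not vanish in the graded ring. -/
theorem toGr_prod_frobeniusForm_ne_zero {K : Type*} [Field K] [Algebra (ZMod 2) K] {m n' k : ℕ}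
    (hk : k ≤ n') {ν : Fin n' → K} (hν : LinearIndependent (ZMod 2) ν) {c : K} (hc : c ≠ 0) :
    toGr _ K (C c * ∏ i : Fin m, ∏ j ∈ Finset.range k, frobeniusForm ν i j) ≠ 0 := by
  classical
  have : CharP K 2 := charP_of_injective_algebraMap (algebraMap (ZMod 2) K).injective 2
  intro h0
  obtain ⟨M, hM⟩ := exists_dual_of_linearIndependent (linearIndependent_moore hk hν)
  -- Substituting through the dual matrix in each block `i` turns the forms into distinct variables.
  -- The product becomes a squarefree monomial, which survives in the graded ring.
  have h := toGr_aeval_eq_zero (τ := Fin m × Fin k)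
    (fun s t => if s.1 = t.1 then M s.2 t.2 else 0) h0
  have hform : ∀ (i : Fin m) (j : Fin k), aeval (fun s : Fin m × Fin n' =>
      ∑ t : Fin m × Fin k, C (if s.1 = t.1 then M s.2 t.2 else 0) * X t) (frobeniusForm ν i j) =
      (X (i, j) : MvPolynomial (Fin m × Fin k) K) := by
    intro i j
    rw [frobeniusForm, map_sum]
    simp only [map_mul, aeval_X, algHom_C, MvPolynomial.algebraMap_eq]
    simp only [Finset.sum_mul]
    rw [Finset.sum_comm, Finset.sum_eq_single (i, j)]
    · have h1 : ∀ l, C (if i = i then M l j else 0) * X (i, j) * C (ν l ^ 2 ^ (j : ℕ)) =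
          C (ν l ^ 2 ^ (j : ℕ) * M l j) * (X (i, j) : MvPolynomial (Fin m × Fin k) K) := by
        intro l; rw [if_pos rfl, C_mul]; ring
      refine (Finset.sum_congr rfl fun l _ => h1 l).trans ?_
      rw [← Finset.sum_mul, ← map_sum, hM, if_pos rfl, C_1, one_mul]
    · rintro ⟨i', j'⟩ _ hne
      by_cases hi : i = i'
      · subst hi
        have hj : j ≠ j' := fun h => hne (by rw [h])
        have h1 : ∀ l, C (if i = i then M l j' else 0) * X (i, j') * C (ν l ^ 2 ^ (j : ℕ)) =
            C (ν l ^ 2 ^ (j : ℕ) * M l j') * (X (i, j') : MvPolynomial (Fin m × Fin k) K) := by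
          intro l; rw [if_pos rfl, C_mul]; ring
        refine (Finset.sum_congr rfl fun l _ => h1 l).trans ?_
        rw [← Finset.sum_mul, ← map_sum, hM, if_neg hj, C_0, zero_mul]
      · simp [hi]
    · simp
  simp only [Finset.prod_range, map_mul, map_prod, hform, algHom_C] at h
  have hprod : (∏ i : Fin m, ∏ j : Fin k, X (i, j) : MvPolynomial (Fin m × Fin k) K) =
      monomial (Finsupp.equivFunOnFinite.symm fun _ => 1) 1 := by
    rw [← Fintype.prod_prod_type, monomial_eq, Finsupp.prod_fintype _ _ (by simp)]
    simp
  have h' : toGr (Fin m × Fin k) K (monomial (Finsupp.equivFunOnFinite.symm fun _ => 1) c) = 0 := by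
    rw [← mul_one c, ← C_mul_monomial, ← hprod, ← h]
    simp only [map_mul, map_prod]
    rfl
  rw [toGr_eq_zero_iff] at h'
  obtain ⟨i, hi⟩ := h' _ (by rw [mem_support_iff, coeff_monomial, if_pos rfl]; exact hc)
  simp at hi

/-- The form already divides the product, so its square appears. -/
theorem toGr_frobeniusForm_mul_prod {K : Type*} [Field K] [CharP K 2] {m n' k : ℕ}
    (ν : Fin n' → K) (c : K) (i : Fin m) {j : ℕ} (hj : j < k) :
    toGr _ K (frobeniusForm ν i j *
      (C c * ∏ i : Fin m, ∏ j ∈ Finset.range k, frobeniusForm ν i j)) = 0 := by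
  obtain ⟨q, hq⟩ : frobeniusForm ν i j ∣ C c * ∏ i : Fin m, ∏ j ∈ Finset.range k, frobeniusForm ν i j :=
    ((Finset.dvd_prod_of_mem _ (Finset.mem_range.mpr hj)).trans
      (Finset.dvd_prod_of_mem (fun i => ∏ j ∈ Finset.range k, frobeniusForm ν i j)
        (Finset.mem_univ i))).trans (Dvd.intro_left _ rfl)
  rw [hq, ← mul_assoc, ← sq, map_mul, toGr_frobeniusForm_sq, zero_mul]

/-! ### Coordinates over `F_2` and the bound for both fields -/

section coord

variable {K σ : Type*} [Field K] [Algebra (ZMod 2) K] {n : ℕ} (b : Module.Basis (Fin n) (ZMod 2) K)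

theorem coordPolynomial_sum {ι : Type*} (s : Finset ι) (p : ι → MvPolynomial σ K) (k : Fin n) :
    coordPolynomial b k (∑ i ∈ s, p i) = ∑ i ∈ s, coordPolynomial b k (p i) := by
  ext e
  simp [coeff_coordPolynomial, coeff_sum]

theorem coordPolynomial_add (p q : MvPolynomial σ K) (k : Fin n) :
    coordPolynomial b k (p + q) = coordPolynomial b k p + coordPolynomial b k q := by
  ext e
  simp [coeff_coordPolynomial]

theorem coordPolynomial_sub (p q : MvPolynomial σ K) (k : Fin n) :
    coordPolynomial b k (p - q) = coordPolynomial b k p - coordPolynomial b k q := by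
  ext e
  simp [coeff_coordPolynomial]

theorem coordPolynomial_zero (k : Fin n) : coordPolynomial b k (0 : MvPolynomial σ K) = 0 := by
  ext e
  simp [coeff_coordPolynomial]

/-- Taking coordinates is linear over the polynomials with coefficients in `F_2`. -/
theorem coordPolynomial_mul_map (p : MvPolynomial σ K) (u : MvPolynomial σ (ZMod 2)) (k : Fin n) :
    coordPolynomial b k (p * MvPolynomial.map (algebraMap (ZMod 2) K) u) =
      coordPolynomial b k p * u := by
  classical
  induction u using MvPolynomial.induction_on with
  | C a =>
    ext e
    rw [map_C, coeff_coordPolynomial, mul_comm, mul_comm (coordPolynomial b k p), coeff_C_mul,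
      coeff_C_mul, coeff_coordPolynomial, ← Algebra.smul_def, map_smul, Finsupp.smul_apply,
      smul_eq_mul]
  | add u v hu hv => rw [map_add, mul_add, coordPolynomial_add, hu, hv, mul_add]
  | mul_X u i hu =>
    rw [map_mul, map_X, ← mul_assoc, ← mul_assoc, ← hu]
    ext e
    rw [coeff_coordPolynomial, coeff_mul_X', coeff_mul_X', coeff_coordPolynomial]
    split_ifs <;> simp

theorem homogeneousComponent_coordPolynomial (p : MvPolynomial σ K) (k : Fin n) (d : ℕ) :
    homogeneousComponent d (coordPolynomial b k p) =
      coordPolynomial b k (homogeneousComponent d p) := by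
  ext e
  rw [coeff_homogeneousComponent, coeff_coordPolynomial, coeff_coordPolynomial,
    coeff_homogeneousComponent]
  split_ifs <;> simp

theorem totalDegree_coordPolynomial_le (p : MvPolynomial σ K) (k : Fin n) :
    (coordPolynomial b k p).totalDegree ≤ p.totalDegree := by
  refine Finset.sup_le fun e he => ?_
  refine le_totalDegree (mem_support_iff.mpr fun h => mem_support_iff.mp he ?_)
  rw [coeff_coordPolynomial, h, map_zero, Finsupp.zero_apply]

theorem IsHomogeneous.coordPolynomial {p : MvPolynomial σ K} {d : ℕ} (hp : p.IsHomogeneous d)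
    (k : Fin n) : (FirstFall.coordPolynomial b k p).IsHomogeneous d := by
  intro e he
  refine hp fun h => he ?_
  rw [coeff_coordPolynomial, h, map_zero, Finsupp.zero_apply]

/-- The generators have coefficients in `F_2`, and taking coordinates is linear over
`F_2`-polynomials, so coordinates stay in the ideal with the same generators. -/
theorem coordPolynomial_mem_span {ι : Type*} {g : ι → MvPolynomial σ (ZMod 2)}
    {p : MvPolynomial σ K}
    (hp : p ∈ Ideal.span (Set.range fun i => MvPolynomial.map (algebraMap (ZMod 2) K) (g i)))
    (k : Fin n) : coordPolynomial b k p ∈ Ideal.span (Set.range g) := by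
  have h : ∀ q, coordPolynomial b k (q * p) ∈ Ideal.span (Set.range g) := by
    refine Submodule.span_induction
      (p := fun x _ => ∀ q, coordPolynomial b k (q * x) ∈ Ideal.span (Set.range g))
      ?_ (fun q => by rw [mul_zero, coordPolynomial_zero]; exact Ideal.zero_mem _)
      (fun x y _ _ hx hy q => by
        rw [mul_add, coordPolynomial_add]; exact Ideal.add_mem _ (hx q) (hy q))
      (fun r x _ hx q => by rw [smul_eq_mul, ← mul_assoc]; exact hx _) hp
    rintro _ ⟨i, rfl⟩ q
    rw [coordPolynomial_mul_map]
    exact Ideal.mul_mem_left _ _ (Ideal.subset_span ⟨i, rfl⟩)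
  simpa using h 1

theorem toBool_coordPolynomial {p : MvPolynomial σ K} (hp : toBool σ K p = 0) (k : Fin n) :
    toBool σ (ZMod 2) (coordPolynomial b k p) = 0 := by
  refine Ideal.Quotient.eq_zero_iff_mem.mpr (coordPolynomial_mem_span b ?_ k)
  simpa using Ideal.Quotient.eq_zero_iff_mem.mp hp

theorem toGr_coordPolynomial {p : MvPolynomial σ K} (hp : toGr σ K p = 0) (k : Fin n) :
    toGr σ (ZMod 2) (coordPolynomial b k p) = 0 := by
  refine Ideal.Quotient.eq_zero_iff_mem.mpr (coordPolynomial_mem_span b ?_ k)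
  simpa using Ideal.Quotient.eq_zero_iff_mem.mp hp

theorem toBool_map_eq_zero {u : MvPolynomial σ (ZMod 2)} (hu : toBool σ (ZMod 2) u = 0) :
    toBool σ K (MvPolynomial.map (algebraMap (ZMod 2) K) u) = 0 := by
  have hle : Ideal.span (Set.range fun i : σ => (X i ^ 2 - X i : MvPolynomial σ (ZMod 2))) ≤
      (Ideal.span (Set.range fun i : σ => (X i ^ 2 - X i : MvPolynomial σ K))).comap
        (MvPolynomial.map (algebraMap (ZMod 2) K)) := by
    rw [Ideal.span_le]
    rintro _ ⟨i, rfl⟩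
    exact Ideal.subset_span ⟨i, by simp⟩
  exact Ideal.Quotient.eq_zero_iff_mem.mpr (hle (Ideal.Quotient.eq_zero_iff_mem.mp hu))

theorem toGr_map_eq_zero {u : MvPolynomial σ (ZMod 2)} (hu : toGr σ (ZMod 2) u = 0) :
    toGr σ K (MvPolynomial.map (algebraMap (ZMod 2) K) u) = 0 := by
  rw [toGr_eq_zero_iff] at hu ⊢
  exact fun e he => hu e (support_map_subset _ _ he)

/-- If all coordinates of a polynomial vanish in the graded ring, so does the polynomial. -/
theorem toGr_eq_zero_of_coordPolynomial {p : MvPolynomial σ K}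
    (h : ∀ k, toGr σ (ZMod 2) (coordPolynomial b k p) = 0) : toGr σ K p = 0 := by
  rw [← sum_coordPolynomial b p, map_sum]
  exact Finset.sum_eq_zero fun k _ => by rw [map_mul, toGr_map_eq_zero (h k), mul_zero]

theorem exists_dual_ne_zero {k M : Type*} [Field k] [AddCommGroup M] [Module k M] {v : M}
    (hv : v ≠ 0) : ∃ φ : M →ₗ[k] k, φ v ≠ 0 := by
  by_contra! h
  exact hv ((Module.forall_dual_apply_eq_zero_iff k v).mp h)

/-- The bound on the first fall degree over `F_2` and over `K`, for the coordinates of a polynomial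
`p` which is congruent to a polynomial `q` whose leading form is annihilated by a linear form. -/
theorem firstFallDegree_coord_le [Finite σ] {p q l : MvPolynomial σ K} {d : ℕ} (hd : 2 ≤ d)
    (hpq : toBool σ K q = toBool σ K p) (hqd : q.totalDegree ≤ d)
    (hq : toGr σ K (homogeneousComponent d q) ≠ 0) (hl : l.IsHomogeneous 1) (hl0 : l ≠ 0)
    (hlq : toGr σ K (l * homogeneousComponent d q) = 0) :
    firstFallDegree (Submodule.span (ZMod 2) (Set.range fun k =>
      toBool σ (ZMod 2) (coordPolynomial b k p))) ≤ ((d + 1 : ℕ) : ℕ∞) ∧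
    firstFallDegree (Submodule.span K (Set.range fun k =>
      toBool σ K (MvPolynomial.map (algebraMap (ZMod 2) K) (coordPolynomial b k p)))) ≤
        ((d + 1 : ℕ) : ℕ∞) := by
  have hk : ∀ k, toBool σ (ZMod 2) (coordPolynomial b k p) =
      toBool σ (ZMod 2) (coordPolynomial b k q) := by
    intro k
    rw [eq_comm, ← sub_eq_zero, ← map_sub, ← coordPolynomial_sub]
    exact toBool_coordPolynomial b (by rw [map_sub, hpq, sub_self]) k
  have hK : ∀ k, toBool σ K (MvPolynomial.map (algebraMap (ZMod 2) K) (coordPolynomial b k p)) =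
      toBool σ K (MvPolynomial.map (algebraMap (ZMod 2) K) (coordPolynomial b k q)) := by
    intro k
    rw [← sub_eq_zero, ← map_sub, ← map_sub]
    exact toBool_map_eq_zero (by rw [map_sub, hk, sub_self])
  have hdeg : ∀ k, (coordPolynomial b k q).totalDegree ≤ d := fun k =>
    (totalDegree_coordPolynomial_le b q k).trans hqd
  constructor
  · obtain ⟨k₀, hk₀⟩ : ∃ k, toGr σ (ZMod 2)
        (homogeneousComponent d (coordPolynomial b k q)) ≠ 0 := by
      by_contra! h
      exact hq (toGr_eq_zero_of_coordPolynomial b fun k => by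
        rw [← homogeneousComponent_coordPolynomial]; exact h k)
    obtain ⟨φ, hφ⟩ := exists_dual_ne_zero (k := ZMod 2) hk₀
    -- Contraction with `φ` turns the tensor of the relation into a coordinate of `l * α`, where `α
    -- = ∑ k, u k • b k` is nonzero; `t` is chosen so that this coordinate does not vanish.
    let u : Fin n → ZMod 2 := fun k =>
      φ (toGr σ (ZMod 2) (homogeneousComponent d (coordPolynomial b k q)))
    have hα : ∑ k, u k • b k ≠ 0 := fun h =>
      hφ (Fintype.linearIndependent_iff.mp b.linearIndependent u h k₀)
    obtain ⟨t, ht⟩ : ∃ t, coordPolynomial b t (l * C (∑ k, u k • b k)) ≠ 0 := by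
      by_contra! h
      have h0 := sum_coordPolynomial b (l * C (∑ k, u k • b k))
      simp only [h, map_zero, mul_zero, Finset.sum_const_zero] at h0
      exact mul_ne_zero hl0 ((C_ne_zero).mpr hα) h0.symm
    refine firstFallDegree_le_succ hd ?_ (fun k => coordPolynomial b k q)
      (fun k => coordPolynomial b t (l * C (b k))) hdeg ?_ ?_ ?_ φ ?_
    · rw [Submodule.span_le]
      rintro _ ⟨k, rfl⟩
      exact ⟨_, (mem_restrictTotalDegree _ _ _).mpr (hdeg k), (hk k).symm⟩
    · intro k
      rw [← hk]
      exact Submodule.subset_span ⟨k, rfl⟩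
    · intro k
      exact IsHomogeneous.coordPolynomial b (hl.mul (isHomogeneous_C σ (b k))) t
    -- The relation over `F_2` is the `t`-th coordinate of `l` times the leading form, after
    -- expanding the leading form in the basis `b`.
    · have : ∑ k, coordPolynomial b t (l * C (b k)) *
          homogeneousComponent d (coordPolynomial b k q) =
          coordPolynomial b t (l * homogeneousComponent d q) := by
        conv_rhs => rw [← sum_coordPolynomial b (homogeneousComponent d q)]
        rw [Finset.mul_sum, coordPolynomial_sum]
        refine Finset.sum_congr rfl fun k _ => ?_
        rw [← mul_assoc, coordPolynomial_mul_map, homogeneousComponent_coordPolynomial]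
      rw [this]
      exact toGr_coordPolynomial b hlq t
    · have : ∑ k, C (u k) * coordPolynomial b t (l * C (b k)) =
          coordPolynomial b t (l * C (∑ k, u k • b k)) := by
        rw [map_sum, Finset.mul_sum, coordPolynomial_sum]
        refine Finset.sum_congr rfl fun k _ => ?_
        rw [mul_comm, ← coordPolynomial_mul_map, map_C, Algebra.smul_def, mul_assoc, ← C_mul,
          mul_comm (b k)]
      change ∑ k, C (u k) * coordPolynomial b t (l * C (b k)) ≠ 0
      rw [this]
      exact ht
  -- Over `K` the class of `q` itself lies in the span, so a relation with the one coefficient `l`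
  -- suffices.
  · obtain ⟨φ, hφ⟩ := exists_dual_ne_zero (k := K) hq
    refine firstFallDegree_le_succ (ι := Unit) hd ?_ (fun _ => q) (fun _ => l) (fun _ => hqd)
      (fun _ => ?_) (fun _ => hl) (by simpa using hlq) φ ?_
    · rw [Submodule.span_le]
      rintro _ ⟨k, rfl⟩
      exact ⟨_, (mem_restrictTotalDegree _ _ _).mpr
        ((Finset.sup_mono (support_map_subset _ _)).trans (hdeg k)), (hK k).symm⟩
    · have hsum := congrArg (toBool σ K) (sum_coordPolynomial b p)
      rw [hpq, ← hsum, map_sum]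
      refine Submodule.sum_mem _ fun k _ => ?_
      rw [← smul_eq_C_mul, map_smul]
      exact Submodule.smul_mem _ _ (Submodule.subset_span ⟨k, rfl⟩)
    · simpa using ⟨hφ, hl0⟩

end coord

/-! ### The bound for the summation polynomials -/

theorem descentPolynomial_eq {K : Type*} [Field K] (a₆ : K) {m n' : ℕ} (ν : Fin n' → K) (c : K) :
    descentPolynomial (m := m) a₆ ν c =
      aeval (fun i => frobeniusForm ν i 0) (semaevAt a₆ m c) := by
  rw [semaevAt, ← AlgHom.comp_apply, comp_aeval, descentPolynomial]
  congr 2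
  funext i
  refine Fin.lastCases ?_ (fun i => ?_) i <;> simp [frobeniusForm]

end

end FirstFall

theorem mainTheorem1 {K : Type*} [Field K] [Algebra (ZMod 2) K]
    {n n' m : ℕ} (hm : 3 ≤ m) (hn' : m ≤ n')
    (z : K) (b : Module.Basis (Fin n) (ZMod 2) K) (hb : ∀ k : Fin n, b k = z ^ (k : ℕ))
    (W : Submodule (ZMod 2) K) (ν : Module.Basis (Fin n') (ZMod 2) W)
    (a₆ : K) (ha₆ : a₆ ≠ 0) (c : K) (hc : c ≠ 0) :
    FirstFall.firstFallDegree (Submodule.span (ZMod 2)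
        (Set.range (FirstFall.reducedSystem a₆ m b (fun l => (ν l : K)) c)))
      ≤ ((m ^ 2 - m + 1 : ℕ) : ℕ∞) ∧
    FirstFall.firstFallDegree (Submodule.span K
        (Set.range (FirstFall.reducedSystemExt a₆ m b (fun l => (ν l : K)) c)))
      ≤ ((m ^ 2 - m + 1 : ℕ) : ℕ∞) := by
  have : CharP K 2 := charP_of_injective_algebraMap (algebraMap (ZMod 2) K).injective 2
  obtain ⟨k, rfl⟩ : ∃ k, m = k + 2 := ⟨m - 2, by omega⟩
  have hd : (k + 2) ^ 2 - (k + 2) = (k + 2) * (k + 1) := by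
    rw [sq, ← Nat.mul_sub_one]; rfl
  have hν : LinearIndependent (ZMod 2) fun l => (ν l : K) :=
    ν.linearIndependent.map' W.subtype (Submodule.ker_subtype W)
  have hp := FirstFall.hasTopShape_semaevAt a₆ k K c
  -- This is where `m ≥ 3` enters: the exponent bound is `2 ^ (k + 1)` with `k + 1 = m - 1`.
  have hk : 2 ≤ k + 1 := by omega
  have hlead := FirstFall.homogeneousComponent_linearizedSubst hk (fun l => (ν l : K)) hp
  have hne := FirstFall.toGr_prod_frobeniusForm_ne_zero (m := k + 2) (k := k + 1) (by omega) hν hc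
  have hann := FirstFall.toGr_frobeniusForm_mul_prod (m := k + 2) (fun l => (ν l : K)) c 0
    (show 0 < k + 1 by omega)
  rw [← hlead] at hne hann
  rw [hd]
  refine FirstFall.firstFallDegree_coord_le b (by nlinarith) ?_
    (FirstFall.totalDegree_linearizedSubst_le hk _ hp.degreeOf_le) hne
    (FirstFall.isHomogeneous_frobeniusForm _ 0 0) ?_ hann
  · rw [FirstFall.descentPolynomial_eq, FirstFall.toBool_linearizedSubst]
  -- The annihilating form is the factor with `i = 0`, `j = 0` of the nonzero leading form, so it is
  -- nonzero.
  · intro h0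
    rw [hlead, Fin.prod_univ_succ, Finset.prod_range_succ'] at hne
    simp [h0] at hne
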